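/- Let $k$ be an algebraically closed field of characteristic zero and $C$ a smooth projective (integral) curve over $k$. Let $X$ and $Y$ be projective schemes over $C$ with $Y$ reduced, and suppose that $X \to C$ is a trivial family, i.e. $X \cong X_0 \times_k C$ over $C$ for some $k$-scheme $X_0$. Let $g : X \to Y$ be a $C$-morphism such that $g^\# : \mathcal{O}_Y \to g_*\mathcal{O}_X$ is an isomorphism. Let $U \subseteq C$ be an open subset over which $Y$ is flat, $Q \in U$ a closed point, $R = \mathcal{O}_{C,Q}$, and let $\tilde R$ be the henselization of $R$, with maximal ideal $\tilde{\mathfrak m}$. For $n \ge 0$ put $R_n = \tilde R/\tilde{\mathfrak m}^{n+1}$, $\tilde Y = (Y \times_C \operatorname{Spec} R) \times_{R} \operatorname{Spec} \tilde R$, $Y_n = \tilde Y \times_{\tilde R} \operatorname{Spec} R_n$, and let $p_n : Y_n \to \operatorname{Spec} R_n$ be the projection; all these schemes are regarded as $k$-schemes through $C$. Then for every $n \ge 0$ the sequence of differentials $$0 \to p_n^*\Omega_{R_n/k} \to \Omega_{Y_n/k} \to \Omega_{Y_n/R_n} \to 0$$ of $\mathcal{O}_{Y_n}$-modules is split exact.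 Hence its extension class in $\operatorname{Ext}^1_{\mathcal{O}_{Y_n}}(\Omega_{Y_n/R_n}, p_n^*\Omega_{R_n/k})$ (the Kodaira–Spencer class of $Y_n/R_n$) vanishes. Moreover, $Y_n \to \operatorname{Spec} R_n$ is trivial, i.e. $Y_n \cong Z \times_k \operatorname{Spec} R_n$ over $R_n$ for some $k$-scheme $Z$; more precisely, $Y_n \cong Y_0 \times_k \operatorname{Spec} R_n$ over $R_n$. -/

import Mathlib

open CategoryTheory CategoryTheory.Limits AlgebraicGeometry TopologicalSpace Opposite

universe u

noncomputable section

namespace KSFamily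

/-! ### Sheaves of relative differentials -/

section Differentials

variable {X S T : Scheme.{u}}

/-- The presheaf inverse image of `𝒪_S` along `f : X ⟶ S`. -/
def invImage (f : X ⟶ S) : TopCat.Presheaf CommRingCat.{u} X :=
  (TopCat.Presheaf.pullback CommRingCat.{u} f.base).obj S.presheaf

/-- The canonical morphism of presheaves of rings `f⁻¹ 𝒪_S ⟶ 𝒪_X`. -/
def invImageHom (f : X ⟶ S) : invImage f ⟶ X.presheaf :=
  ((TopCat.Presheaf.pullbackPushforwardAdjunction CommRingCat.{u} f.base).homEquiv
    S.presheaf X.presheaf).symm f.c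

/-- The presheaf `U ↦ Ω_{𝒪_X(U) / (f⁻¹ 𝒪_S)(U)}`. -/
def omegaPre (f : X ⟶ S) : X.PresheafOfModules :=
  PresheafOfModules.DifferentialsConstruction.relativeDifferentials' (invImageHom f)

/-- The sheaf of relative differentials `Ω_{X/S}`. -/
def omega (f : X ⟶ S) : X.Modules :=
  (PresheafOfModules.sheafification (𝟙 X.ringCatSheaf.obj)).obj (omegaPre f)

/-- `S`-derivations of `𝒪_X` with values in an `𝒪_X`-module. -/
abbrev Der (f : X ⟶ S) (M : X.PresheafOfModules) : Type _ :=
  PresheafOfModules.Derivation (F := Opens.map f.base) (R := X.presheaf) M f.c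


variable {f : X ⟶ S}

/-- The sections of `𝒪_X` over `U` that a derivation kills. -/
def Der.constSubring {M : X.PresheafOfModules} (D : Der f M) (U : X.Opensᵒᵖ) :
    Subring (X.presheaf.obj U) where
  carrier := {x | D.d (X := U) x = 0}
  zero_mem' := map_zero _
  one_mem' := D.d_one U
  add_mem' {a b} ha hb := by
    have ha' : D.d (X := U) a = 0 := ha
    have hb' : D.d (X := U) b = 0 := hb
    change D.d (X := U) (a + b) = 0
    rw [map_add, ha', hb', add_zero]
  neg_mem' {a} ha := by
    have ha' : D.d (X := U) a = 0 := ha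
    change D.d (X := U) (-a) = 0
    rw [map_neg, ha', neg_zero]
  mul_mem' {a b} ha hb := by
    have ha' : D.d (X := U) a = 0 := ha
    have hb' : D.d (X := U) b = 0 := hb
    change D.d (X := U) (a * b) = 0
    rw [D.d_mul, ha', hb', smul_zero, smul_zero, add_zero]

/-- The presheaf of rings of the sections that a derivation kills. -/
def Der.constPresheaf {M : X.PresheafOfModules} (D : Der f M) :
    TopCat.Presheaf CommRingCat.{u} X where
  obj U := CommRingCat.of (D.constSubring U)
  map {U V} i := CommRingCat.ofHom <|
    ((X.presheaf.map i).hom.comp (D.constSubring U).subtype).codRestrict (D.constSubring V)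
      (fun x ↦ by
        have hx : D.d (X := U) x.1 = 0 := x.2
        change D.d (X := V) (X.presheaf.map i x.1) = 0
        rw [D.d_map, hx]
        exact map_zero _)
  map_id U := by
    ext x
    exact congr($(X.presheaf.map_id U) x.1)
  map_comp i j := by
    ext x
    exact congr($(X.presheaf.map_comp i j) x.1)

/-- The inclusion into `𝒪_X`. -/
def Der.constι {M : X.PresheafOfModules} (D : Der f M) : D.constPresheaf ⟶ X.presheaf where
  app U := CommRingCat.ofHom (D.constSubring U).subtype

lemma Der.d_invImageHom {M : X.PresheafOfModules} (D : Der f M) {U : X.Opensᵒᵖ}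
    (a : (invImage f).obj U) : D.d (X := U) ((invImageHom f).app U a) = 0 := by
  let ψ : S.presheaf ⟶ (TopCat.Presheaf.pushforward CommRingCat f.base).obj D.constPresheaf :=
    { app := fun V ↦ CommRingCat.ofHom <|
        (f.c.app V).hom.codRestrict (D.constSubring ((Opens.map f.base).op.obj V))
          (fun x ↦ D.d_app x)
      naturality := fun V W i ↦ by
        ext x
        exact Subtype.ext (congr($(f.c.naturality i) x)) }
  have h : invImageHom f = ((TopCat.Presheaf.pullbackPushforwardAdjunction CommRingCat.{u}
      f.base).homEquiv S.presheaf D.constPresheaf).symm ψ ≫ D.constι := by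
    rw [← Adjunction.homEquiv_naturality_right_symm]
    rfl
  rw [h]
  exact (((((TopCat.Presheaf.pullbackPushforwardAdjunction CommRingCat.{u}
      f.base).homEquiv S.presheaf D.constPresheaf).symm ψ).app U) a).2

/-- An `S`-derivation is a derivation relative to `f⁻¹ 𝒪_S ⟶ 𝒪_X`. -/
def Der.toInvImage {M : X.PresheafOfModules} (D : Der f M) :
    PresheafOfModules.Derivation' (R := X.presheaf) M (invImageHom f) where
  d := D.d
  d_mul := D.d_mul
  d_map := D.d_map
  d_app a := D.d_invImageHom a

/-- The map `omegaPre f ⟶ M` that a derivation induces. -/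
def omegaPreDesc {M : X.PresheafOfModules} (D : Der f M) : omegaPre f ⟶ M :=
  (PresheafOfModules.DifferentialsConstruction.isUniversal' (invImageHom f)).desc D.toInvImage

/-- The map `Ω_{X/S} ⟶ M` that a derivation `𝒪_X ⟶ M` induces. -/
def omegaDesc {M : X.Modules} (D : Der f M.val) : omega f ⟶ M :=
  ((PresheafOfModules.sheafificationAdjunction (𝟙 X.ringCatSheaf.obj)).homEquiv _ _).symm
    (omegaPreDesc D)

/-- The presheaf derivation `𝒪_X ⟶ omegaPre f`. -/
def derPre (f : X ⟶ S) : Der f (omegaPre f) where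
  d := (PresheafOfModules.DifferentialsConstruction.derivation' (invImageHom f)).d
  d_mul := (PresheafOfModules.DifferentialsConstruction.derivation' (invImageHom f)).d_mul
  d_map := (PresheafOfModules.DifferentialsConstruction.derivation' (invImageHom f)).d_map
  d_app {V} a := by
    have h : (f.c.app V) a = (invImageHom f).app (op ((Opens.map f.base).obj V.unop))
        ((((TopCat.Presheaf.pullbackPushforwardAdjunction CommRingCat.{u} f.base).unit.app
          S.presheaf).app V) a) := by
      have := ((TopCat.Presheaf.pullbackPushforwardAdjunction CommRingCat.{u}
        f.base).homEquiv S.presheaf X.presheaf).apply_symm_apply f.c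
      rw [Adjunction.homEquiv_unit] at this
      exact congr($(this.symm).app V a)
    rw [h]
    exact PresheafOfModules.Derivation'.d_app
      (PresheafOfModules.DifferentialsConstruction.derivation' (invImageHom f)) _

/-- The universal derivation `𝒪_X ⟶ Ω_{X/S}`. -/
def der (f : X ⟶ S) : Der f (omega f).val :=
  (derPre f).postcomp
    ((PresheafOfModules.sheafificationAdjunction (𝟙 X.ringCatSheaf.obj)).unit.app (omegaPre f))

lemma omegaDesc_d {M : X.Modules} (D : Der f M.val) {U : X.Opensᵒᵖ} (x : X.presheaf.obj U) :
    (omegaDesc D).val.app U ((der f).d (X := U) x) = D.d (X := U) x := by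
  have h1 : (PresheafOfModules.sheafificationAdjunction (𝟙 X.ringCatSheaf.obj)).unit.app
      (omegaPre f) ≫ (omegaDesc D).val = omegaPreDesc D := by
    have := ((PresheafOfModules.sheafificationAdjunction (𝟙 X.ringCatSheaf.obj)).homEquiv
      (omegaPre f) M).apply_symm_apply (omegaPreDesc D)
    exact (Adjunction.homEquiv_unit _ _ _ _).symm.trans this
  have h2 := PresheafOfModules.Derivation.congr_d
    ((PresheafOfModules.DifferentialsConstruction.isUniversal' (invImageHom f)).fac
      D.toInvImage) (X := U) x
  exact (congr(($h1).app U ((derPre f).d (X := U) x)) :).trans h2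

lemma omega_hom_ext {M : X.Modules} {α β : omega f ⟶ M}
    (h : ∀ (U : X.Opensᵒᵖ) (x : X.presheaf.obj U),
      α.val.app U ((der f).d (X := U) x) = β.val.app U ((der f).d (X := U) x)) : α = β := by
  apply ((PresheafOfModules.sheafificationAdjunction (𝟙 X.ringCatSheaf.obj)).homEquiv
    (omegaPre f) M).injective
  refine (Adjunction.homEquiv_unit _ _ _ _).trans (Eq.trans ?_ (Adjunction.homEquiv_unit _ _ _ _).symm)
  apply (PresheafOfModules.DifferentialsConstruction.isUniversal'
    (invImageHom f)).postcomp_injective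
  ext U x
  exact h U x

/-- The natural map `Ω_{X/T} ⟶ Ω_{X/S}`, `dx ↦ dx`, for `X ⟶ S ⟶ T`. -/
def omegaToRel (f : X ⟶ S) (h : S ⟶ T) : omega (f ≫ h) ⟶ omega f :=
  omegaDesc (f := f ≫ h)
    { d := (der f).d
      d_mul := (der f).d_mul
      d_map := (der f).d_map
      d_app := fun {V} a ↦ (der f).d_app (X := op (h ⁻¹ᵁ V.unop)) (h.c.app V a) }

/-- The natural map `Ω_{S/T} ⟶ f_* Ω_{X/T}`, `ds ↦ d(f^# s)`, for `X ⟶ S ⟶ T`. -/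
def omegaToPushforward (f : X ⟶ S) (h : S ⟶ T) :
    omega h ⟶ (Scheme.Modules.pushforward f).obj (omega (f ≫ h)) :=
  omegaDesc (f := h)
    { d := fun {V} ↦ ((der (f ≫ h)).d (X := op (f ⁻¹ᵁ V.unop))).comp
        (f.c.app V).hom.toAddMonoidHom
      d_mul := fun {V} a b ↦ by
        refine Eq.trans ?_ ((der (f ≫ h)).d_mul (X := op (f ⁻¹ᵁ V.unop))
          (f.c.app V a) (f.c.app V b))
        exact congrArg ((der (f ≫ h)).d (X := op (f ⁻¹ᵁ V.unop))) (map_mul (f.c.app V).hom a b)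
      d_map := fun {V W} i a ↦ by
        refine Eq.trans ?_ ((der (f ≫ h)).d_map ((Opens.map f.base).op.map i) (f.c.app V a))
        exact congrArg ((der (f ≫ h)).d (X := op (f ⁻¹ᵁ W.unop))) congr($(f.c.naturality i) a)
      d_app := fun {V} a ↦ (der (f ≫ h)).d_app (X := V) a }

/-- The natural map `f^* Ω_{S/T} ⟶ Ω_{X/T}`, adjoint to `Ω_{S/T} ⟶ f_* Ω_{X/T}`. -/
def pullbackOmega (f : X ⟶ S) (h : S ⟶ T) :
    (Scheme.Modules.pullback f).obj (omega h) ⟶ omega (f ≫ h) :=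
  ((Scheme.Modules.pullbackPushforwardAdjunction f).homEquiv _ _).symm (omegaToPushforward f h)

lemma pullbackOmega_comp_omegaToRel (f : X ⟶ S) (h : S ⟶ T) :
    pullbackOmega f h ≫ omegaToRel f h = 0 := by
  apply ((Scheme.Modules.pullbackPushforwardAdjunction f).homEquiv _ _).injective
  rw [Adjunction.homEquiv_naturality_right, pullbackOmega, Equiv.apply_symm_apply]
  have hz : (Scheme.Modules.pullbackPushforwardAdjunction f).homEquiv (omega h) (omega f) 0 =
      0 := by
    rw [Adjunction.homEquiv_unit, Functor.map_zero, comp_zero]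
  rw [hz]
  apply omega_hom_ext (f := h)
  intro V s
  have h1 : (omegaToPushforward f h).val.app V ((der h).d (X := V) s) =
      (der (f ≫ h)).d (X := op (f ⁻¹ᵁ V.unop)) (f.c.app V s) := omegaDesc_d _ s
  have h2 : (omegaToRel f h).val.app (op (f ⁻¹ᵁ V.unop))
      ((der (f ≫ h)).d (X := op (f ⁻¹ᵁ V.unop)) (f.c.app V s)) =
      (der f).d (X := op (f ⁻¹ᵁ V.unop)) (f.c.app V s) := omegaDesc_d _ _
  have h3 : (der f).d (X := op (f ⁻¹ᵁ V.unop)) (f.c.app V s) = 0 := (der f).d_app s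
  exact (congrArg (fun t ↦ (omegaToRel f h).val.app (op (f ⁻¹ᵁ V.unop)) t) h1).trans (h2.trans h3)

/-- The sequence of differentials `f^* Ω_{S/T} ⟶ Ω_{X/T} ⟶ Ω_{X/S}` of `X ⟶ S ⟶ T`. -/
def differentialSequence (f : X ⟶ S) (h : S ⟶ T) : ShortComplex X.Modules :=
  .mk (pullbackOmega f h) (omegaToRel f h) (pullbackOmega_comp_omegaToRel f h)

/-- The class in `Ext¹(Ω_{X/S}, f^* Ω_{S/T})` of the extension
`0 ⟶ f^* Ω_{S/T} ⟶ Ω_{X/T} ⟶ Ω_{X/S} ⟶ 0`; it is this class whose image in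
`H⁰(S, R¹f_* T_{X/S} ⊗ Ω_{S/T})`, for smooth `X/S`, is the Kodaira–Spencer class. -/
def kodairaSpencerExtClass (f : X ⟶ S) (h : S ⟶ T)
    (hs : (differentialSequence f h).ShortExact) :
    letI := HasExt.standard X.Modules
    Abelian.Ext (omega f) ((Scheme.Modules.pullback f).obj (omega h)) 1 :=
  letI := HasExt.standard X.Modules
  hs.extClass

end Differentials

/-! ### Projective morphisms and trivial families -/

/-- Projective space `ℙⁿ_ℤ`. -/
def projectiveSpaceInt (n : ℕ) : Scheme.{u} :=
  letI := MvPolynomial.gradedAlgebra (σ := Fin (n + 1)) (R := ULift.{u} ℤ)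
  Proj (MvPolynomial.homogeneousSubmodule (Fin (n + 1)) (ULift.{u} ℤ))

/-- Projective space `ℙⁿ_S`. -/
def projectiveSpace (n : ℕ) (S : Scheme.{u}) : Scheme.{u} :=
  pullback (terminal.from S) (terminal.from (projectiveSpaceInt.{u} n))

/-- `X ⟶ S` is projective: it factors as a closed immersion into some `ℙⁿ_S`
followed by the projection. -/
def IsProjectiveMorphism {X S : Scheme.{u}} (f : X ⟶ S) : Prop :=
  ∃ (n : ℕ) (j : X ⟶ projectiveSpace n S), IsClosedImmersion j ∧ j ≫ pullback.fst _ _ = f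

/-- For a `k`-scheme `S`, a family `π : X ⟶ S` is trivial if `X ≅ X₀ ×_k S` over `S`
for some `k`-scheme `X₀`. (Such a `π` is automatically flat.) -/
def IsTrivialFamily {k : Type u} [Field k] {X S : Scheme.{u}}
    (s : S ⟶ Spec (.of k)) (π : X ⟶ S) : Prop :=
  ∃ (X₀ : Scheme.{u}) (x₀ : X₀ ⟶ Spec (.of k)) (e : X ≅ pullback x₀ s),
    e.hom ≫ pullback.snd x₀ s = π

/-! ### Henselization -/

/-- `(A', i)` is a henselization of the local ring `A`: `A'` is a henselian local ring, `i` is a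
local homomorphism, and every local homomorphism from `A` to a henselian local ring factors
uniquely through `i` by a local homomorphism. -/
structure IsHenselization {A A' : Type u} [CommRing A] [IsLocalRing A] [CommRing A']
    [IsLocalRing A'] (i : A →+* A') : Prop where
  henselian : HenselianLocalRing A'
  isLocalHom : IsLocalHom i
  existsUnique_lift : ∀ (B : Type u) [CommRing B] [HenselianLocalRing B] (v : A →+* B),
    IsLocalHom v → ∃! w : A' →+* B, IsLocalHom w ∧ w.comp i = v

/-! ### The infinitesimal neighbourhoods of a fibre -/

section Truncations

variable {C Y : Scheme.{u}} (pY : Y ⟶ C) (Q : C)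
  {R' : Type u} [CommRing R'] [IsLocalRing R'] (i : C.presheaf.stalk Q →+* R') (n : ℕ)

/-- `R_n = R' / 𝔪'^(n+1)`. -/
abbrev TruncRing (R' : Type u) [CommRing R'] [IsLocalRing R'] (n : ℕ) : Type u :=
  R' ⧸ IsLocalRing.maximalIdeal R' ^ (n + 1)

/-- `Spec R_n ⟶ Spec R'`. -/
def truncToHensel (R' : Type u) [CommRing R'] [IsLocalRing R'] (n : ℕ) :
    Spec (.of (TruncRing R' n)) ⟶ Spec (.of R') :=
  Spec.map (CommRingCat.ofHom (Ideal.Quotient.mk _))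

/-- `Spec R' ⟶ Spec R` for a homomorphism `R ⟶ R'`, where `R = 𝒪_{C,Q}`. -/
def henselToLocal : Spec (.of R') ⟶ Spec (C.presheaf.stalk Q) :=
  Spec.map (CommRingCat.ofHom i)

/-- The composition `Spec R_n ⟶ Spec R' ⟶ Spec R ⟶ C`. -/
def truncToCurve : Spec (.of (TruncRing R' n)) ⟶ C :=
  truncToHensel R' n ≫ henselToLocal Q i ≫ C.fromSpecStalk Q

/-- `Y_R = Y ×_C Spec R` with `R = 𝒪_{C,Q}`. -/
def localFamily : Scheme.{u} := pullback pY (C.fromSpecStalk Q)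

/-- `Y_R ⟶ Spec R`. -/
def localFamilyHom : localFamily pY Q ⟶ Spec (C.presheaf.stalk Q) := pullback.snd _ _

/-- `Y' = Y_R ×_R Spec R'`. -/
def henselFamily : Scheme.{u} := pullback (localFamilyHom pY Q) (henselToLocal Q i)

/-- `Y' ⟶ Spec R'`. -/
def henselFamilyHom : henselFamily pY Q i ⟶ Spec (.of R') := pullback.snd _ _

/-- `Y_n = Y' ×_{R'} Spec R_n`. -/
def truncFamily : Scheme.{u} := pullback (henselFamilyHom pY Q i) (truncToHensel R' n)

/-- `p_n : Y_n ⟶ Spec R_n`. -/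
def truncFamilyHom : truncFamily pY Q i n ⟶ Spec (.of (TruncRing R' n)) := pullback.snd _ _

end Truncations

end KSFamily

end

/-! The morphism `g` remembers enough of `Y` to trivialize it infinitesimally. Let `A` be the ring
of an affine neighbourhood of `Q` with a local parameter `t`, `A/(t) = k`, and let `T = Spec
A/(t^m)`. Over `T` the family `X` becomes `X₀ × T`, and the structure sheaf of `Y_T` is still the
direct image of that of `X_T` (`isIso_app_of_isPullback`). For injectivity, a function on `Y` that
dies on `X_T` is divisible by `t^m` on `X`, and the quotient descends because `𝒪_Y = g_* 𝒪_X`. For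
surjectivity, functions on `X₀ × T` are generated by those of `X₀` and of `T`, all of which lift to
`X`; as `g` is closed, the lifts descend locally to `Y`.

With `m = 1` the same argument shows that the fibre `Y₁` of `Y` carries the direct image of
`𝒪_{X₀}`. Flat base change along `T ⟶ Spec k` then shows that `Y₁ × T` carries the direct image of
`𝒪_{X₀ × T}`. Thus `Y_T` and `Y₁ × T` have the same space and the same sheaf
(`exists_isPullback_of_thickening`). Since `A ⟶ R_n` kills `t^(n+1)`, `Y_n` is a base change of such
a `Y_T`, hence of `Y₁`. To replace `Y₁` by `Y_0` one needs `R_0 = k`: henselization does not enlarge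
the residue field (`IsHenselization.surjective_residue`).

Finally, on a product `Z × T` with `T` a point, derivations are pairs of derivations on the two
factors. The universal derivation is the sum of its parts along `Z` and along `T`, which give a
section and a retraction of the sequence of differentials (`nonempty_splitting_of_isPullback`). -/

noncomputable section

namespace KSFamily

/-! ### Derivations of a tensor product of rings -/

section PushoutDerivations

variable {R A B P : CommRingCat.{u}} {f : R ⟶ A} {g : R ⟶ B} {i : A ⟶ P} {j : B ⟶ P}
  {N : Type u} [AddCommGroup N] [Module P N]

/-- The ring homomorphism `a ↦ (φ a, d a)` into the trivial square-zero extension. -/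
def sqZeroLift [Module Pᵐᵒᵖ N] [IsCentralScalar P N] {A : Type u} [CommRing A] (φ : A →+* P)
    (d : A →+ N) (hd : ∀ a b, d (a * b) = φ a • d b + φ b • d a) :
    A →+* TrivSqZeroExt P N where
  toFun a := (φ a, d a)
  map_one' := by
    have h : d 1 = 0 := by simpa using hd 1 1
    rw [h, map_one]; rfl
  map_zero' := by rw [map_zero, map_zero]; rfl
  map_add' a b := by rw [map_add, map_add]; rfl
  map_mul' a b := by
    rw [map_mul, hd]
    refine TrivSqZeroExt.ext rfl ?_
    change _ = φ a • d b + MulOpposite.op (φ b) • d a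
    rw [op_smul_eq_smul]
    rfl

/-- Derivations on the two factors of a tensor product extend to it. -/
lemma exists_derivation_of_isPushout (h : IsPushout f g i j)
    (d₁ : A →+ N) (h₁ : ∀ a b, d₁ (a * b) = i a • d₁ b + i b • d₁ a) (hf : ∀ r, d₁ (f r) = 0)
    (d₂ : B →+ N) (h₂ : ∀ a b, d₂ (a * b) = j a • d₂ b + j b • d₂ a) (hg : ∀ r, d₂ (g r) = 0) :
    ∃ D : P →+ N, (∀ a b, D (a * b) = a • D b + b • D a) ∧ (∀ a, D (i a) = d₁ a) ∧
      ∀ b, D (j b) = d₂ b := by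
  let _ : Module Pᵐᵒᵖ N := Module.compHom N ((RingHom.id P).fromOpposite fun _ _ ↦ mul_comm _ _)
  have : IsCentralScalar P N := ⟨fun _ _ ↦ rfl⟩
  let φ₁ : A ⟶ CommRingCat.of (TrivSqZeroExt P N) := CommRingCat.ofHom (sqZeroLift i.hom d₁ h₁)
  let φ₂ : B ⟶ CommRingCat.of (TrivSqZeroExt P N) := CommRingCat.ofHom (sqZeroLift j.hom d₂ h₂)
  have hφ : f ≫ φ₁ = g ≫ φ₂ := by
    ext r
    · exact congr($(h.w) r)
    · exact (hf r).trans (hg r).symm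
  let Φ : P ⟶ CommRingCat.of (TrivSqZeroExt P N) := h.desc φ₁ φ₂ hφ
  -- The first component of `Φ` is the identity, so multiplicativity of `Φ` is the Leibniz rule for
  -- its second component.
  have hΦ : Φ ≫ CommRingCat.ofHom (TrivSqZeroExt.fstHom P P N).toRingHom = 𝟙 P := by
    apply h.hom_ext
    · rw [← Category.assoc, h.inl_desc, Category.comp_id]; rfl
    · rw [← Category.assoc, h.inr_desc, Category.comp_id]; rfl
  have hfst (x : P) : (Φ x).fst = x := congr($hΦ x)
  refine ⟨(TrivSqZeroExt.sndHom P N).toAddMonoidHom.comp Φ.hom.toAddMonoidHom, ?_, ?_, ?_⟩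
  · intro a b
    change (Φ (a * b)).snd = a • (Φ b).snd + b • (Φ a).snd
    rw [map_mul]
    refine (TrivSqZeroExt.snd_mul _ _).trans ?_
    rw [hfst, hfst, op_smul_eq_smul]
  · intro a
    exact congr(TrivSqZeroExt.snd ($(h.inl_desc φ₁ φ₂ hφ) a))
  · intro b
    exact congr(TrivSqZeroExt.snd ($(h.inr_desc φ₁ φ₂ hφ) b))

/-- A derivation is a ring homomorphism to the square-zero extension, and those out of a pushout are
determined on the two factors. -/
lemma derivation_ext_of_isPushout (h : IsPushout f g i j) {D D' : P →+ N}
    (hD : ∀ a b, D (a * b) = a • D b + b • D a) (hD' : ∀ a b, D' (a * b) = a • D' b + b • D' a)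
    (hi : ∀ a, D (i a) = D' (i a)) (hj : ∀ b, D (j b) = D' (j b)) : D = D' := by
  let _ : Module Pᵐᵒᵖ N := Module.compHom N ((RingHom.id P).fromOpposite fun _ _ ↦ mul_comm _ _)
  have : IsCentralScalar P N := ⟨fun _ _ ↦ rfl⟩
  have key : CommRingCat.ofHom (sqZeroLift (RingHom.id P) D hD) =
      CommRingCat.ofHom (sqZeroLift (RingHom.id P) D' hD') := by
    apply h.hom_ext
    · ext a
      exacts [rfl, hi a]
    · ext b
      exacts [rfl, hj b]
  ext x
  exact congr(TrivSqZeroExt.snd ($key x))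

end PushoutDerivations

/-! ### Extending additive maps from a basis -/

section SheafOnBasis

variable {X : Scheme.{u}} (M : X.Modules)

/-- A section of a sheaf of modules is determined by its restrictions to the members of a basis. -/
lemma Modules.section_ext {ι : Type*} {B : ι → X.Opens} (hB : Opens.IsBasis (Set.range B))
    {U : X.Opens} {s t : M.presheaf.obj (op U)}
    (h : ∀ b (hb : B b ≤ U), M.presheaf.map (homOfLE hb).op s = M.presheaf.map (homOfLE hb).op t) :
    s = t := by
  let F : TopCat.Sheaf Ab X := ⟨M.presheaf, M.isSheaf⟩
  refine TopCat.Sheaf.eq_of_locally_eq' F (fun b : { b // B b ≤ U } ↦ B b.1) U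
    (fun b ↦ homOfLE b.2) ?_ s t (fun b ↦ h b.1 b.2)
  intro x hx
  obtain ⟨_, ⟨b, rfl⟩, hxb, hbU⟩ := Opens.isBasis_iff_nbhd.mp hB hx
  exact Opens.mem_iSup.mpr ⟨⟨b, hbU⟩, hxb⟩

/-- Compatible additive maps on a basis with values in a sheaf of modules extend. -/
lemma Modules.exists_addHom_of_basis {ι : Type*} {B : ι → X.Opens}
    (hB : Opens.IsBasis (Set.range B))
    (d : ∀ b, X.presheaf.obj (op (B b)) →+ M.presheaf.obj (op (B b)))
    (hd : ∀ b c (h : B c ≤ B b) x, d c (X.presheaf.map (homOfLE h).op x) =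
      M.presheaf.map (homOfLE h).op (d b x)) :
    ∃ D : ∀ U : X.Opens, X.presheaf.obj (op U) →+ M.presheaf.obj (op U),
      (∀ U V (h : V ≤ U) x, D V (X.presheaf.map (homOfLE h).op x) =
        M.presheaf.map (homOfLE h).op (D U x)) ∧ ∀ b, D (B b) = d b := by
  let F' : TopCat.Sheaf Ab X := ⟨M.presheaf, M.isSheaf⟩
  let F : TopCat.Presheaf Ab X := X.presheaf ⋙ forget₂ CommRingCat RingCat ⋙ forget₂ RingCat Ab
  let α : (inducedFunctor B).op ⋙ F ⟶ (inducedFunctor B).op ⋙ F'.1 :=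
    { app := fun b ↦ AddCommGrpCat.ofHom (d b.unop)
      naturality := fun b c i ↦ by
        ext x
        exact hd b.unop c.unop (leOfHom i.unop.hom) x }
  let β := TopCat.Sheaf.restrictHomEquivHom F F' hB α
  refine ⟨fun U ↦ (β.app (op U)).hom, fun U V h x ↦ ?_, fun b ↦ ?_⟩
  · exact congr($(β.naturality (homOfLE h).op) x)
  · exact congr(($(TopCat.Sheaf.extend_hom_app F F' hB α b)).hom)

end SheafOnBasis

/-! ### Derivations on a product of schemes -/

section ProductDerivations

variable {Y Z T K : Scheme.{u}} {q : Y ⟶ Z} {p : Y ⟶ T} {z : Z ⟶ K} {t : T ⟶ K}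

/-- A derivation, as a natural family of additive maps that satisfy the Leibniz rule. -/
structure IsDerivation (M : Y.Modules)
    (D : ∀ U : Y.Opens, Γ(Y, U) →+ Γ(M, U)) : Prop where
  map : ∀ U V (h : V ≤ U) x, D V (Y.presheaf.map (homOfLE h).op x) =
    M.presheaf.map (homOfLE h).op (D U x)
  mul : ∀ U (a b : Γ(Y, U)), D U (a * b) = a • D U b + b • D U a

/-- The underlying family of additive maps. -/
def Der.fam {f : Y ⟶ K} {M : Y.Modules} (D : Der f M.val) (U : Y.Opens) : Γ(Y, U) →+ Γ(M, U) :=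
  D.d (X := op U)

lemma Der.isDerivation {f : Y ⟶ K} {M : Y.Modules} (D : Der f M.val) : IsDerivation M D.fam where
  map _ _ h x := D.d_map (homOfLE h).op x
  mul U a b := D.d_mul (X := op U) a b

lemma IsDerivation.add {M : Y.Modules} {D D' : ∀ U : Y.Opens, Γ(Y, U) →+ Γ(M, U)}
    (h : IsDerivation M D) (h' : IsDerivation M D') : IsDerivation M (fun U ↦ D U + D' U) where
  map U V i x := by
    rw [AddMonoidHom.add_apply, AddMonoidHom.add_apply, h.map, h'.map, map_add]
  mul U a b := by
    simp only [AddMonoidHom.add_apply, h.mul, h'.mul, smul_add]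
    abel

lemma IsDerivation.comp {M N : Y.Modules} {D : ∀ U : Y.Opens, Γ(Y, U) →+ Γ(M, U)}
    (h : IsDerivation M D) (φ : M ⟶ N) :
    IsDerivation N (fun U ↦ (φ.app U).hom.comp (D U)) where
  map U V i x := by
    change φ.app V (D V _) = N.presheaf.map _ (φ.app U (D U x))
    rw [h.map]
    exact congr($(φ.mapPresheaf.naturality (homOfLE i).op) (D U x))
  mul U a b := by
    change φ.app U (D U _) = a • φ.app U (D U b) + b • φ.app U (D U a)
    rw [h.mul, map_add, Scheme.Modules.Hom.app_smul, Scheme.Modules.Hom.app_smul]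

lemma isBasis_preimage_affineOpens (hq : ∀ W : Y.Opens, ∃ V : Z.Opens, q ⁻¹ᵁ V = W) :
    Opens.IsBasis (Set.range fun V : Z.affineOpens ↦ q ⁻¹ᵁ V.1) := by
  rw [Opens.isBasis_iff_nbhd]
  intro W x hx
  obtain ⟨V, rfl⟩ := hq W
  obtain ⟨V', hV', hxV', hle⟩ := Opens.isBasis_iff_nbhd.mp Z.isBasis_affineOpens
    (show q x ∈ V from hx)
  exact ⟨_, ⟨⟨V', hV'⟩, rfl⟩, hxV', q.preimage_mono hle⟩

/-- The open set `q ⁻¹ᵁ V` is the product of the affine schemes `V` and `T` over the affine scheme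
`K`, so its ring is a tensor product. -/
lemma isPushout_sections_of_isPullback (H : IsPullback q p z t) [IsAffine T] [IsAffine K]
    (V : Z.affineOpens) :
    IsPushout (z.appLE ⊤ V le_top) t.appTop (q.app V) (p.appLE ⊤ (q ⁻¹ᵁ V.1) le_top) := by
  have := (isIso_pushoutSection_iff H (US := ⊤) (UT := ⊤) (UX := V.1) (UY := q ⁻¹ᵁ V.1)
    le_top le_top (by simp)).mp (isIso_pushoutSection_of_isAffineOpen H _ _ _
      (isAffineOpen_top K) (isAffineOpen_top T) V.2)
  rw [Scheme.Hom.appLE_eq_app] at this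
  convert this using 1
  exact (Scheme.Hom.appLE_eq_app t).symm

lemma isDerivation_ext (H : IsPullback q p z t) [IsAffine T] [IsAffine K]
    (hq : ∀ W : Y.Opens, ∃ V : Z.Opens, q ⁻¹ᵁ V = W) {M : Y.Modules}
    {D D' : ∀ U : Y.Opens, Γ(Y, U) →+ Γ(M, U)} (hD : IsDerivation M D) (hD' : IsDerivation M D')
    (h₁ : ∀ V (x : Γ(Z, V)), D (q ⁻¹ᵁ V) (q.app V x) = D' (q ⁻¹ᵁ V) (q.app V x))
    (h₂ : ∀ b : Γ(T, ⊤), D ⊤ (p.appTop b) = D' ⊤ (p.appTop b)) : D = D' := by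
  have key (V : Z.affineOpens) : D (q ⁻¹ᵁ V.1) = D' (q ⁻¹ᵁ V.1) := by
    refine derivation_ext_of_isPushout (isPushout_sections_of_isPullback H V) (hD.mul _)
      (hD'.mul _) (h₁ V.1) fun b ↦ ?_
    have hb : p.appLE ⊤ (q ⁻¹ᵁ V.1) le_top b =
        Y.presheaf.map (homOfLE le_top).op (p.appTop b) := rfl
    rw [hb]
    exact (hD.map ⊤ _ le_top _).trans ((congrArg _ (h₂ b)).trans (hD'.map ⊤ _ le_top _).symm)
  ext U x
  refine Modules.section_ext M (isBasis_preimage_affineOpens hq) fun V hV ↦ ?_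
  rw [← hD.map, ← hD'.map]
  exact congr($(key V) _)

/-- On each `q ⁻¹ᵁ V` with `V` affine the two derivations extend to the tensor product; uniqueness
there gives compatibility with restriction, so the extensions glue. -/
lemma exists_der_of_isPullback (H : IsPullback q p z t) [IsAffine T] [IsAffine K]
    (hq : ∀ W : Y.Opens, ∃ V : Z.Opens, q ⁻¹ᵁ V = W) (hs : Function.Surjective q)
    {M : Y.Modules}
    (d₁ : Der z ((Scheme.Modules.pushforward q).obj M).val)
    (d₂ : Der t ((Scheme.Modules.pushforward p).obj M).val) :
    ∃ D : Der (p ≫ t) M.val, (∀ V (x : Γ(Z, V)), D.fam (q ⁻¹ᵁ V) (q.app V x) = d₁.fam V x) ∧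
      ∀ b : Γ(T, ⊤), D.fam ⊤ (p.appTop b) = d₂.fam ⊤ b := by
  have hB := isBasis_preimage_affineOpens hq
  have ex (V : Z.affineOpens) := exists_derivation_of_isPushout
    (N := Γ(M, q ⁻¹ᵁ V.1))
    (isPushout_sections_of_isPullback H V) (d₁.fam V.1)
    (fun a b ↦ d₁.isDerivation.mul V.1 a b)
    (fun r ↦ by
      refine (d₁.isDerivation.map (z ⁻¹ᵁ ⊤) _ le_top (z.appTop r)).trans ?_
      have : d₁.fam (z ⁻¹ᵁ ⊤) (z.appTop r) = 0 := d₁.d_app (X := op ⊤) r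
      exact (congrArg (M.presheaf.map
        ((Opens.map q.base).map (homOfLE (le_top : V.1 ≤ z ⁻¹ᵁ ⊤))).op) this).trans
        (map_zero (M.presheaf.map
          ((Opens.map q.base).map (homOfLE (le_top : V.1 ≤ z ⁻¹ᵁ ⊤))).op).hom))
    ((M.presheaf.map (homOfLE (le_top : q ⁻¹ᵁ V.1 ≤ ⊤)).op).hom.comp (d₂.fam ⊤))
    (fun a b ↦ by
      refine (congrArg (M.presheaf.map (homOfLE (le_top : q ⁻¹ᵁ V.1 ≤ ⊤)).op)
        (d₂.isDerivation.mul ⊤ a b)).trans ?_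
      refine (map_add _ _ _).trans ?_
      exact congrArg₂ (· + ·) (M.map_smul (homOfLE (le_top : q ⁻¹ᵁ V.1 ≤ ⊤)) _ _)
        (M.map_smul (homOfLE (le_top : q ⁻¹ᵁ V.1 ≤ ⊤)) _ _))
    (fun r ↦ by
      have : d₂.fam ⊤ (t.appTop r) = 0 := d₂.d_app (X := op ⊤) r
      exact (congrArg (M.presheaf.map (homOfLE (le_top : q ⁻¹ᵁ V.1 ≤ ⊤)).op) this).trans
        (map_zero (M.presheaf.map (homOfLE (le_top : q ⁻¹ᵁ V.1 ≤ ⊤)).op).hom))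
  choose d hmul hd₁ hd₂ using ex
  -- The index of the basis consists of opens of `Z`, while compatibility concerns opens of `Y`;
  -- surjectivity of `q` allows the passage.
  have hle {V W : Z.Opens} (h : q ⁻¹ᵁ W ≤ q ⁻¹ᵁ V) : W ≤ V := by
    intro x hx
    obtain ⟨y, rfl⟩ := hs x
    exact h hx
  have happ {V W : Z.Opens} (h : q ⁻¹ᵁ W ≤ q ⁻¹ᵁ V) (x : Γ(Z, V)) :
      Y.presheaf.map (homOfLE h).op (q.app V x) =
        q.app W (Z.presheaf.map (homOfLE (hle h)).op x) :=
    congr($(q.naturality (homOfLE (hle h)).op) x).symm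
  obtain ⟨D, hDmap, hDd⟩ := Modules.exists_addHom_of_basis M hB d (by
    intro V W h x
    suffices hs : (d W).comp (Y.presheaf.map (homOfLE h).op).hom.toAddMonoidHom =
        (M.presheaf.map (homOfLE h).op).hom.comp (d V) from congr($hs x)
    -- Both composites are derivations on the larger open set with values in sections over the
    -- smaller one, viewed as a module by restriction.
    let _ : Module Γ(Y, q ⁻¹ᵁ V.1) Γ(M, q ⁻¹ᵁ W.1) :=
      Module.compHom _ (Y.presheaf.map (homOfLE h).op).hom
    refine derivation_ext_of_isPushout (isPushout_sections_of_isPullback H V) ?_ ?_ ?_ ?_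
    · intro a b
      exact (congrArg (d W) (map_mul (Y.presheaf.map (homOfLE h).op).hom a b)).trans
        (hmul W _ _)
    · intro a b
      refine (congrArg (M.presheaf.map (homOfLE h).op) (hmul V a b)).trans ?_
      refine (map_add (M.presheaf.map (homOfLE h).op).hom _ _).trans ?_
      exact congrArg₂ (· + ·) (M.map_smul (homOfLE h) _ _) (M.map_smul (homOfLE h) _ _)
    · intro a
      refine (congrArg (d W) (happ h a)).trans ((hd₁ W _).trans ?_)
      exact (d₁.isDerivation.map V.1 W.1 (hle h) a).trans
        (congrArg (M.presheaf.map (homOfLE h).op) (hd₁ V a)).symm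
    · intro b
      have hb : Y.presheaf.map (homOfLE h).op (p.appLE ⊤ (q ⁻¹ᵁ V.1) le_top b) =
          p.appLE ⊤ (q ⁻¹ᵁ W.1) le_top b := by
        exact congr($(Scheme.Hom.appLE_map (U := ⊤) p le_top (homOfLE h).op) b)
      refine (congrArg (d W) hb).trans ((hd₂ W _).trans ?_)
      refine Eq.trans ?_ (congrArg (M.presheaf.map (homOfLE h).op) (hd₂ V b)).symm
      exact congr($(M.presheaf.map_comp (homOfLE (le_top : q ⁻¹ᵁ V.1 ≤ ⊤)).op
        (homOfLE h).op) (d₂.fam ⊤ b)))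
  have hmul' (U : Y.Opens) (a b : Γ(Y, U)) : D U (a * b) = a • D U b + b • D U a := by
    refine Modules.section_ext M hB fun V hV ↦ ?_
    rw [← hDmap, hDd, map_mul, hmul, map_add, Scheme.Modules.map_smul, Scheme.Modules.map_smul,
      ← hDmap, ← hDmap, hDd]
  have hq₁ (V) (x : Γ(Z, V)) : D (q ⁻¹ᵁ V) (q.app V x) = d₁.fam V x := by
    refine Modules.section_ext M hB fun W hW ↦ ?_
    rw [← hDmap, hDd, happ hW]
    exact (hd₁ W _).trans (d₁.isDerivation.map V W.1 (hle hW) x)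
  refine ⟨⟨fun {U} ↦ D U.unop, fun {U} a b ↦ hmul' U.unop a b,
    fun {U V} i x ↦ hDmap U.unop V.unop (leOfHom i.unop) x, fun {U} a ↦ ?_⟩, hq₁, fun b ↦ ?_⟩
  · change D ((p ≫ t) ⁻¹ᵁ U.unop) ((p ≫ t).app U.unop a) = 0
    -- A function from `K` also comes through `Z`, where `d₁` kills it.
    have h0 : D ((q ≫ z) ⁻¹ᵁ U.unop) ((q ≫ z).app U.unop a) = 0 := by
      rw [Scheme.Hom.comp_app]
      exact (hq₁ _ _).trans (d₁.d_app a)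
    convert h0 using 2
    all_goals rw [H.w]
  · refine Modules.section_ext M hB fun W hW ↦ ?_
    change _ = M.presheaf.map _ (d₂.fam ⊤ b)
    refine Eq.trans ?_ (hd₂ W b)
    refine (hDmap ⊤ _ hW _).symm.trans ?_
    rw [hDd]
    rfl

end ProductDerivations

/-! ### Splitting of the sequence of differentials -/

section Splitting

variable {Y Z T K : Scheme.{u}} {q : Y ⟶ Z} {p : Y ⟶ T} {z : Z ⟶ K} {t : T ⟶ K}

/-- The derivation `x ↦ D (q^# x)` with values in `q_* M`. -/
def Der.pushforward {M : Y.Modules} (D : Der (q ≫ z) M.val) :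
    Der z ((Scheme.Modules.pushforward q).obj M).val where
  d := fun {V} ↦ (D.d (X := op (q ⁻¹ᵁ V.unop))).comp (q.c.app V).hom.toAddMonoidHom
  d_mul := fun {V} a b ↦ by
    refine Eq.trans ?_ (D.d_mul (X := op (q ⁻¹ᵁ V.unop)) (q.c.app V a) (q.c.app V b))
    exact congrArg (D.d (X := op (q ⁻¹ᵁ V.unop))) (map_mul (q.c.app V).hom a b)
  d_map := fun {V W} i a ↦ by
    refine Eq.trans ?_ (D.d_map ((Opens.map q.base).op.map i) (q.c.app V a))
    exact congrArg (D.d (X := op (q ⁻¹ᵁ W.unop))) congr($(q.c.naturality i) a)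
  d_app := fun {V} a ↦ D.d_app (X := V) a

/-- The zero derivation. -/
def Der.zero (f : Y ⟶ K) (M : Y.Modules) : Der f M.val where
  d := 0
  d_mul a b := by
    refine Eq.symm ((congrArg₂ (· + ·) (smul_zero a) (smul_zero b)).trans (add_zero _))
  d_map i x := (map_zero (M.val.map i).hom).symm
  d_app _ := rfl

lemma eq_top_or_subsingleton_sections [Subsingleton T] (U : T.Opens) :
    U = ⊤ ∨ Subsingleton Γ(T, U) := by
  by_cases h : ∃ x, x ∈ U
  · obtain ⟨x, hx⟩ := h
    exact .inl (eq_top_iff.mpr fun y _ ↦ Subsingleton.elim x y ▸ hx)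
  · have : U = ⊥ := eq_bot_iff.mpr fun x hx ↦ (h ⟨x, hx⟩).elim
    subst this
    exact .inr inferInstance

lemma omegaToRel_d (p : Y ⟶ T) (t : T ⟶ K) (U : Y.Opens) (x : Γ(Y, U)) :
    (omegaToRel p t).app U ((der (p ≫ t)).fam U x) = (der p).fam U x :=
  omegaDesc_d _ (U := op U) x

lemma omegaToPushforward_d (p : Y ⟶ T) (t : T ⟶ K) (U : T.Opens) (b : Γ(T, U)) :
    (omegaToPushforward p t).app U ((der t).fam U b) =
      (der (p ≫ t)).fam (p ⁻¹ᵁ U) (p.app U b) :=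
  omegaDesc_d (f := t) _ (U := op U) b

lemma unit_comp_pullbackOmega (p : Y ⟶ T) (t : T ⟶ K) :
    (Scheme.Modules.pullbackPushforwardAdjunction p).unit.app (omega t) ≫
      (Scheme.Modules.pushforward p).map (pullbackOmega p t) = omegaToPushforward p t :=
  (Adjunction.homEquiv_unit _ _ _ _).symm.trans (Equiv.apply_symm_apply _ _)

lemma pullbackOmega_d (p : Y ⟶ T) (t : T ⟶ K) (U : T.Opens) (b : Γ(T, U)) :
    (pullbackOmega p t).app (p ⁻¹ᵁ U)
      (((Scheme.Modules.pullbackPushforwardAdjunction p).unit.app (omega t)).app U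
        ((der t).fam U b)) = (der (p ≫ t)).fam (p ⁻¹ᵁ U) (p.app U b) :=
  Eq.trans congr(($(unit_comp_pullbackOmega p t)).app U ((der t).fam U b))
    (omegaToPushforward_d p t U b)

lemma omega_hom_ext_fam {f : Y ⟶ K} {M : Y.Modules} {α β : omega f ⟶ M}
    (h : ∀ U x, α.app U ((der f).fam U x) = β.app U ((der f).fam U x)) : α = β :=
  omega_hom_ext fun U x ↦ h U.unop x

/-- By adjunction the identity is tested on the forms `db` on `T`; as `T` has one point, only global
`b` matter. -/
lemma pullbackOmega_comp_eq_id [Subsingleton T] (p : Y ⟶ T) (t : T ⟶ K)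
    (r : omega (p ≫ t) ⟶ (Scheme.Modules.pullback p).obj (omega t))
    (hr : ∀ b : Γ(T, ⊤), r.app (p ⁻¹ᵁ ⊤) ((der (p ≫ t)).fam (p ⁻¹ᵁ ⊤) (p.appTop b)) =
      ((Scheme.Modules.pullbackPushforwardAdjunction p).unit.app (omega t)).app ⊤
        ((der t).fam ⊤ b)) :
    pullbackOmega p t ≫ r = 𝟙 _ := by
  apply ((Scheme.Modules.pullbackPushforwardAdjunction p).homEquiv _ _).injective
  rw [Adjunction.homEquiv_naturality_right, pullbackOmega, Equiv.apply_symm_apply,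
    Adjunction.homEquiv_id]
  refine omega_hom_ext_fam (f := t) fun U b ↦ ?_
  obtain rfl | h := eq_top_or_subsingleton_sections U
  · exact (congrArg (r.app (p ⁻¹ᵁ ⊤)) (omegaToPushforward_d p t ⊤ b)).trans (hr b)
  · obtain rfl : b = 0 := Subsingleton.elim _ _
    rw [map_zero, map_zero, map_zero]

/-- If `Y = Z × T` for a one-point affine scheme `T`, then the sequence of differentials of
`Y ⟶ T` splits. -/
theorem nonempty_splitting_of_isPullback (H : IsPullback q p z t) [IsAffine T] [IsAffine K]
    [Subsingleton T]
    (hq : ∀ W : Y.Opens, ∃ V : Z.Opens, q ⁻¹ᵁ V = W) (hs : Function.Surjective q) :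
    Nonempty (differentialSequence p t).Splitting := by
  let η := (Scheme.Modules.pullbackPushforwardAdjunction p).unit.app (omega t)
  -- `DZ` is the part of `d` along `T`: it kills the functions from `Z`. It yields the retraction.
  obtain ⟨DZ, hZq, hZp⟩ := exists_der_of_isPullback H hq hs
    (M := (Scheme.Modules.pullback p).obj (omega t)) (Der.zero _ _)
    ((der t).postcomp η.val)
  have hqz : ∃ D : Der (q ≫ z) (omega (p ≫ t)).val, ∀ U, D.fam U = (der (p ≫ t)).fam U := by
    rw [H.w]
    exact ⟨_, fun _ ↦ rfl⟩
  obtain ⟨Dq, hDq⟩ := hqz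
  -- `DT` is the part of `d` along `Z`: it kills the functions from `T`, hence is a derivation
  -- relative to `p` and yields the section.
  obtain ⟨DT, hTq, hTp⟩ := exists_der_of_isPullback H hq hs
    (M := omega (p ≫ t)) Dq.pushforward (Der.zero _ _)
  have hTp' {U : T.Opensᵒᵖ} (b : T.presheaf.obj U) :
      DT.d (X := op (p ⁻¹ᵁ U.unop)) (p.c.app U b) = 0 := by
    obtain h | h := eq_top_or_subsingleton_sections U.unop
    · obtain rfl : U = op ⊤ := congrArg op h
      exact hTp b
    · obtain rfl : b = 0 := @Subsingleton.elim _ h _ _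
      exact (congrArg (DT.d (X := op (p ⁻¹ᵁ U.unop))) (map_zero (p.c.app U).hom)).trans
        (map_zero _)
  let DT' : Der p (omega (p ≫ t)).val := ⟨DT.d, DT.d_mul, DT.d_map, hTp'⟩
  let r : omega (p ≫ t) ⟶ (Scheme.Modules.pullback p).obj (omega t) := omegaDesc DZ
  let s : omega p ⟶ omega (p ≫ t) := omegaDesc DT'
  have hr (U : Y.Opens) (x : Γ(Y, U)) : r.app U ((der (p ≫ t)).fam U x) = DZ.fam U x :=
    omegaDesc_d DZ (U := op U) x
  have hs' (U : Y.Opens) (x : Γ(Y, U)) : s.app U ((der p).fam U x) = DT.fam U x :=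
    omegaDesc_d DT' (U := op U) x
  have hTq' (V) (x : Γ(Z, V)) : DT.fam (q ⁻¹ᵁ V) (q.app V x) =
      (der (p ≫ t)).fam (q ⁻¹ᵁ V) (q.app V x) :=
    (hTq V x).trans congr($(hDq (q ⁻¹ᵁ V)) (q.app V x))
  have hTp₀ (b : Γ(T, ⊤)) : DT.fam ⊤ (p.appTop b) = 0 := hTp b
  refine ⟨⟨r, s, ?_, ?_, ?_⟩⟩
  · exact pullbackOmega_comp_eq_id p t r fun b ↦ (hr _ _).trans (hZp b)
  · change s ≫ omegaToRel p t = 𝟙 (omega p)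
    refine omega_hom_ext_fam fun U x ↦ ?_
    refine (congrArg ((omegaToRel p t).app U) (hs' U x)).trans ?_
    refine congr($(isDerivation_ext H hq (DT.isDerivation.comp (omegaToRel p t))
      (der p).isDerivation (fun V x ↦ ?_) fun b ↦ ?_) U x)
    · exact (congrArg ((omegaToRel p t).app _) (hTq' V x)).trans (omegaToRel_d _ _ _ _)
    · refine (congrArg ((omegaToRel p t).app _) (hTp₀ b)).trans ((map_zero _).trans ?_)
      exact ((der p).d_app (X := op ⊤) b).symm
  -- This is the decomposition of `d` into its two parts, checked on functions from `Z` and from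
  -- `T`.
  · change r ≫ pullbackOmega p t + omegaToRel p t ≫ s = 𝟙 (omega (p ≫ t))
    refine omega_hom_ext_fam fun U x ↦ ?_
    refine (congrArg₂ (· + ·) (congrArg ((pullbackOmega p t).app U) (hr U x))
      ((congrArg (s.app U) (omegaToRel_d p t U x)).trans (hs' U x))).trans ?_
    refine congr($(isDerivation_ext H hq ((DZ.isDerivation.comp (pullbackOmega p t)).add
      DT.isDerivation) (der (p ≫ t)).isDerivation (fun V x ↦ ?_) fun b ↦ ?_) U x)
    · refine (congrArg₂ (· + ·) ((congrArg ((pullbackOmega p t).app _) (hZq V x)).trans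
        (map_zero _)) (hTq' V x)).trans (zero_add _)
    · refine (congrArg₂ (· + ·) ((congrArg ((pullbackOmega p t).app _) (hZp b)).trans
        (pullbackOmega_d p t ⊤ b)) (hTp₀ b)).trans (add_zero _)

/-- The extension class dies when pushed out along `S.f`, and `S.f` has a left inverse. -/
lemma extClass_eq_zero_of_splitting {C : Type*} [Category C] [Abelian C] [HasExt C]
    {S : ShortComplex C} (hS : S.ShortExact) (s : S.Splitting) : hS.extClass = 0 := by
  have h : hS.extClass = hS.extClass.comp (Abelian.Ext.mk₀ (S.f ≫ s.r)) (add_zero 1) := by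
    rw [s.f_r, Abelian.Ext.comp_mk₀_id]
  rw [h, ← Abelian.Ext.mk₀_comp_mk₀, hS.extClass_comp_assoc]

end Splitting

/-! ### Recovering a scheme from a direct image -/

section IsoOfPushforward

/-- The comorphism is the composite `𝒪_B ≅ b_* 𝒪_X = φ_* a_* 𝒪_X ≅ φ_* 𝒪_A`. -/
lemma exists_presheafedSpace_iso {X A B : PresheafedSpace CommRingCat.{u}} (a : X ⟶ A) (b : X ⟶ B)
    [IsIso a.c] [IsIso b.c] (φ : A.carrier ≅ B.carrier) (h : a.base ≫ φ.hom = b.base) :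
    ∃ e : A ≅ B, a ≫ e.hom = b := by
  obtain ⟨bb, bc⟩ := b
  dsimp only at h
  subst h
  let bc' : B.presheaf ⟶ (TopCat.Presheaf.pushforward CommRingCat φ.hom).obj
    ((TopCat.Presheaf.pushforward CommRingCat a.base).obj X.presheaf) := bc
  have : IsIso bc' := ‹_›
  let c : B.presheaf ⟶ (TopCat.Presheaf.pushforward CommRingCat φ.hom).obj A.presheaf :=
    bc' ≫ (TopCat.Presheaf.pushforward CommRingCat φ.hom).map (inv a.c)
  have hc : IsIso c := IsIso.comp_isIso
  have h1 : c ≫ (TopCat.Presheaf.pushforward CommRingCat φ.hom).map a.c = bc' := by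
    rw [Category.assoc, ← Functor.map_comp, IsIso.inv_hom_id, CategoryTheory.Functor.map_id, Category.comp_id]
  let F : A ⟶ B := { base := φ.hom, c := c }
  have : IsIso F.base := inferInstanceAs (IsIso φ.hom)
  have : IsIso F.c := hc
  have : IsIso F := PresheafedSpace.isIso_of_components F
  refine ⟨asIso F, PresheafedSpace.Hom.ext _ _ rfl ?_⟩
  ext U : 2
  refine congrArg CommRingCat.Hom.hom ?_
  refine (congrArg (fun f ↦ f ≫ _) congr(($h1).app (op U))).trans ?_
  exact (congrArg _ (X.presheaf.map_id _)).trans (Category.comp_id _)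

/-- Two schemes with the same underlying space and with structure sheaves that are the
direct images of the same structure sheaf are isomorphic. -/
lemma exists_iso_of_isIso_app {X A B : Scheme.{u}} (a : X ⟶ A) (b : X ⟶ B)
    (ha : ∀ U, IsIso (a.app U)) (hb : ∀ U, IsIso (b.app U)) (φ : A ≃ₜ B)
    (h : ∀ x, φ (a x) = b x) : ∃ e : A ≅ B, a ≫ e.hom = b := by
  have : IsIso a.c := (NatTrans.isIso_iff_isIso_app _).mpr fun U ↦ ha U.unop
  have : IsIso b.c := (NatTrans.isIso_iff_isIso_app _).mpr fun U ↦ hb U.unop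
  obtain ⟨e, he⟩ := exists_presheafedSpace_iso a.toLRSHom.toHom b.toLRSHom.toHom
    (TopCat.isoOfHomeo φ) (by ext x; exact h x)
  let e' : A ≅ B := Scheme.fullyFaithfulForgetToLocallyRingedSpace.preimageIso
    (LocallyRingedSpace.isoOfSheafedSpaceIso (SheafedSpace.isoMk e))
  refine ⟨e', ?_⟩
  apply Scheme.fullyFaithfulForgetToLocallyRingedSpace.map_injective
  apply LocallyRingedSpace.Hom.ext'
  exact he

end IsoOfPushforward

/-! ### Projective morphisms are proper -/

section Projective

lemma bijective_algebraMap_homogeneousSubmodule_zero (σ R : Type*) [CommRing R] :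
    letI := MvPolynomial.gradedAlgebra (σ := σ) (R := R)
    Function.Bijective (algebraMap R (MvPolynomial.homogeneousSubmodule σ R 0)) := by
  constructor
  · intro a b h
    exact MvPolynomial.C_injective σ R congr($h.1)
  · rintro ⟨x, hx⟩
    rw [MvPolynomial.homogeneousSubmodule_zero, Submodule.mem_one] at hx
    obtain ⟨a, rfl⟩ := hx
    exact ⟨a, rfl⟩

/-- `Proj` is proper over the spectrum of the degree-zero part, which here is `ℤ`. -/
instance isProper_projectiveSpaceInt (n : ℕ) :
    IsProper (terminal.from (projectiveSpaceInt.{u} n)) := by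
  let R := ULift.{u} ℤ
  let 𝒜 := MvPolynomial.homogeneousSubmodule (Fin (n + 1)) R
  let _ := MvPolynomial.gradedAlgebra (σ := Fin (n + 1)) (R := R)
  have hbij : Function.Bijective (algebraMap R (𝒜 0)) :=
    bijective_algebraMap_homogeneousSubmodule_zero (Fin (n + 1)) R
  have : IsScalarTower R (𝒜 0) (MvPolynomial (Fin (n + 1)) R) :=
    IsScalarTower.of_algebraMap_eq (R := R) (S := 𝒜 0) fun _ ↦ rfl
  have : Algebra.FiniteType (𝒜 0) (MvPolynomial (Fin (n + 1)) R) :=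
    Algebra.FiniteType.of_restrictScalars_finiteType R _ _
  let φ : CommRingCat.of R ⟶ CommRingCat.of (𝒜 0) := CommRingCat.ofHom (algebraMap R (𝒜 0))
  have : IsIso φ := (ConcreteCategory.isIso_iff_bijective φ).mpr hbij
  have h : terminal.from (projectiveSpaceInt.{u} n) =
      Proj.toSpecZero 𝒜 ≫ Spec.map φ ≫ terminal.from (Spec (.of R)) := Subsingleton.elim _ _
  have : IsIso (terminal.from (Spec (.of R))) :=
    isIso_of_isTerminal specULiftZIsTerminal terminalIsTerminal _
  rw [h]
  have : IsProper (Proj.toSpecZero 𝒜) := inferInstance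
  have : IsProper (Spec.map φ ≫ terminal.from (Spec (.of R))) := inferInstance
  exact inferInstanceAs (IsProper (Proj.toSpecZero 𝒜 ≫ Spec.map φ ≫ terminal.from (Spec (.of R))))

lemma IsProjectiveMorphism.isProper {X S : Scheme.{u}} {f : X ⟶ S} (hf : IsProjectiveMorphism f) :
    IsProper f := by
  obtain ⟨n, j, hj, rfl⟩ := hf
  have : IsProper (pullback.fst (terminal.from S) (terminal.from (projectiveSpaceInt.{u} n))) :=
    inferInstance
  let j' : X ⟶ pullback (terminal.from S) (terminal.from (projectiveSpaceInt.{u} n)) := j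
  have : IsClosedImmersion j' := hj
  exact inferInstanceAs (IsProper (j' ≫ pullback.fst _ _))

end Projective

/-! ### Local parameters on smooth curves -/

section LocalParameter

open TensorProduct

variable {k A : Type u} [Field k] [CommRing A] [Algebra k A]

/-- As `A/m = k` is formally smooth over `k`, the space `m/m²` embeds into `Ω ⊗ A/m`, which is
one-dimensional. The functional `δ` is this embedding in coordinates. -/
lemma exists_mem_le_span_sup_sq [Algebra.IsStandardSmoothOfRelativeDimension 1 k A]
    (m : Ideal A) [m.IsMaximal] (hk : Function.Bijective (algebraMap k (A ⧸ m))) :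
    ∃ t ∈ m, m ≤ Ideal.span {t} ⊔ m ^ 2 := by
  have : Algebra.IsStandardSmooth k A :=
    Algebra.IsStandardSmoothOfRelativeDimension.isStandardSmooth 1
  have : Nontrivial A := ⟨0, 1, fun h ↦ Ideal.IsPrime.ne_top' (I := m)
    ((Ideal.eq_top_iff_one m).mpr (h ▸ m.zero_mem))⟩
  have hsm : Algebra.FormallySmooth k (A ⧸ m) :=
    .of_equiv (AlgEquiv.ofBijective (Algebra.ofId k (A ⧸ m)) hk)
  have hinj : Function.Injective (KaehlerDifferential.kerCotangentToTensor k A (A ⧸ m)) :=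
    (Algebra.FormallySmooth.kerCotangentToTensor_injective_iff Ideal.Quotient.mk_surjective).mpr
      inferInstance
  have hrank : Module.rank A Ω[A⁄k] = 1 := by
    exact_mod_cast Algebra.IsStandardSmoothOfRelativeDimension.rank_kaehlerDifferential
      (R := k) (S := A) 1
  obtain ⟨e⟩ : Nonempty (Ω[A⁄k] ≃ₗ[A] A) := by
    apply nonempty_linearEquiv_of_rank_eq
    rw [hrank, Module.rank_self]
  have hker : RingHom.ker (algebraMap A (A ⧸ m)) = m := Ideal.mk_ker
  let δ : A → A ⧸ m := fun x ↦ Ideal.Quotient.mk m (e (KaehlerDifferential.D k A x))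
  let Ψ : (A ⧸ m) ⊗[A] Ω[A⁄k] ≃ₗ[A] A ⧸ m :=
    (TensorProduct.congr (LinearEquiv.refl A _) e).trans (TensorProduct.rid A _)
  have hδ (x : A) (hx : x ∈ m) (h0 : δ x = 0) : x ∈ m ^ 2 := by
    let x' : RingHom.ker (algebraMap A (A ⧸ m)) := ⟨x, Ideal.Quotient.eq_zero_iff_mem.mpr hx⟩
    have h1 : KaehlerDifferential.kerCotangentToTensor k A (A ⧸ m) (Ideal.toCotangent _ x') = 0 := by
      rw [KaehlerDifferential.kerCotangentToTensor_toCotangent]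
      apply Ψ.injective
      rw [map_zero]
      refine Eq.trans ?_ h0
      simp [Ψ, x', δ, Algebra.smul_def]
    have h2 := hinj (h1.trans (map_zero _).symm)
    rw [Ideal.toCotangent_eq_zero] at h2
    exact (congrArg (fun I : Ideal A ↦ x ∈ I ^ 2) hker).mp h2
  have hδsub (a t x : A) (ht : t ∈ m) : δ (x - a * t) = δ x - Ideal.Quotient.mk m a * δ t := by
    simp only [δ]
    rw [map_sub, Derivation.leibniz, map_sub, map_add, map_smul, map_smul, map_sub, map_add,
      smul_eq_mul, smul_eq_mul, map_mul, map_mul, Ideal.Quotient.eq_zero_iff_mem.mpr ht,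
      zero_mul, add_zero]
  by_cases h : ∃ t ∈ m, δ t ≠ 0
  · obtain ⟨t, ht, h0⟩ := h
    refine ⟨t, ht, fun x hx ↦ ?_⟩
    let _ := Ideal.Quotient.field m
    obtain ⟨a, ha⟩ := Ideal.Quotient.mk_surjective (δ x / δ t)
    have : x - a * t ∈ m ^ 2 := by
      refine hδ _ (m.sub_mem hx (m.mul_mem_left a ht)) ?_
      rw [hδsub a t x ht, ha, div_mul_cancel₀ _ h0, sub_self]
    rw [← add_sub_cancel (a * t) x]
    exact add_mem (Ideal.mem_sup_left (Ideal.mem_span_singleton'.mpr ⟨a, rfl⟩))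
      (Ideal.mem_sup_right this)
  · push Not at h
    -- Here `m = m²`, so `t = 0` serves; this case is excluded later by the rank of `Ω`.
    exact ⟨0, m.zero_mem, fun x hx ↦ Ideal.mem_sup_right (hδ x hx (h x hx))⟩

/-- A rational point of a smooth affine curve has a local parameter. -/
lemma exists_local_parameter [IsDomain A] [Algebra.IsStandardSmoothOfRelativeDimension 1 k A]
    (m : Ideal A) [m.IsMaximal] (hk : Function.Bijective (algebraMap k (A ⧸ m))) :
    ∃ r, r ∉ m ∧ ∃ t ∈ m, t ≠ 0 ∧ ∀ (B : Type u) [CommRing B] [Algebra A B] [Algebra k B]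
      [IsScalarTower k A B] [IsLocalization.Away r B],
      Function.Bijective (algebraMap k (B ⧸ Ideal.span {algebraMap A B t})) := by
  have : Algebra.IsStandardSmooth k A :=
    Algebra.IsStandardSmoothOfRelativeDimension.isStandardSmooth 1
  have : IsNoetherianRing A := Algebra.FiniteType.isNoetherianRing k A
  obtain ⟨t, ht, hle⟩ := exists_mem_le_span_sup_sq m hk
  -- Nakayama for the image of `m` in `A/(t)`, which equals `m` times itself: some `r ≡ 1` modulo
  -- `m` kills it. After inverting `r`, `t` generates `m`.
  obtain ⟨r, hr, hrm⟩ : ∃ r : A, r - 1 ∈ m ∧ ∀ x ∈ m, r * x ∈ Ideal.span {t} := by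
    let π : A →ₗ[A] A ⧸ Ideal.span {t} := Submodule.mkQ (Ideal.span {t})
    obtain ⟨r, hr, h⟩ := Submodule.exists_sub_one_mem_and_smul_eq_zero_of_fg_of_le_smul m
      (Submodule.map π m) (Submodule.FG.map π (IsNoetherian.noetherian m)) (by
        rw [← Submodule.map_smul'']
        rintro _ ⟨x, hx, rfl⟩
        obtain ⟨y, hy, z, hz, rfl⟩ := Submodule.mem_sup.mp (hle hx)
        refine ⟨z, by rwa [smul_eq_mul, ← pow_two], ?_⟩
        have hy0 : π y = 0 := (Submodule.Quotient.mk_eq_zero _).mpr hy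
        rw [map_add, hy0, zero_add])
    refine ⟨r, hr, fun x hx ↦ ?_⟩
    exact (Submodule.Quotient.mk_eq_zero _).mp (h (π x) ⟨x, hx, rfl⟩)
  have hrm' : r ∉ m := fun h ↦ Ideal.IsPrime.ne_top' (I := m) ((Ideal.eq_top_iff_one m).mpr (by
    simpa using m.sub_mem h hr))
  -- If `t = 0`, then `m = 0` in the domain `A`, so `k` surjects onto `A` and `Ω = 0`, against rank
  -- one.
  have ht0 : t ≠ 0 := by
    rintro rfl
    have hm : m = ⊥ := by
      rw [eq_bot_iff]
      intro x hx
      have := hrm x hx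
      rw [Ideal.mem_span_singleton, zero_dvd_iff] at this
      exact (mul_eq_zero.mp this).resolve_left (fun h ↦ hrm' (h ▸ m.zero_mem))
    have hs : Function.Surjective (algebraMap k A) := by
      intro a
      obtain ⟨b, hb⟩ := hk.2 (Ideal.Quotient.mk m a)
      refine ⟨b, ?_⟩
      have : algebraMap k A b - a ∈ m := Ideal.Quotient.eq.mp hb
      rw [hm, Ideal.mem_bot, sub_eq_zero] at this
      exact this
    have : Subsingleton Ω[A⁄k] := KaehlerDifferential.subsingleton_of_surjective k A hs
    have hrank : Module.rank A Ω[A⁄k] = 1 := by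
      exact_mod_cast Algebra.IsStandardSmoothOfRelativeDimension.rank_kaehlerDifferential
        (R := k) (S := A) 1
    rw [rank_subsingleton'] at hrank
    exact zero_ne_one hrank
  refine ⟨r, hrm', t, ht, ht0, fun B _ _ _ _ _ ↦ ?_⟩
  have hru : IsUnit (algebraMap A B r) := IsLocalization.Away.algebraMap_isUnit r
  have hmB (x : A) (hx : x ∈ m) : algebraMap A B x ∈ Ideal.span {algebraMap A B t} := by
    rw [← Ideal.unit_mul_mem_iff_mem _ hru, ← map_mul]
    obtain ⟨c, hc⟩ := Ideal.mem_span_singleton'.mp (hrm x hx)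
    exact Ideal.mem_span_singleton'.mpr ⟨algebraMap A B c, by rw [← hc, map_mul]⟩
  constructor
  · have : Nontrivial (B ⧸ Ideal.span {algebraMap A B t}) := by
      rw [Ideal.Quotient.nontrivial_iff, Ne, Ideal.span_singleton_eq_top]
      rintro h
      obtain ⟨b, hb⟩ := h.exists_right_inv
      obtain ⟨n, a, ha⟩ := IsLocalization.Away.surj r b
      have hinj : Function.Injective (algebraMap A B) :=
        IsLocalization.injective B (powers_le_nonZeroDivisors_of_noZeroDivisors
          (fun h : r = 0 ↦ hrm' (h ▸ m.zero_mem)))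
      have : r ^ n = t * a := by
        apply hinj
        rw [map_mul, ← ha, map_pow, ← mul_assoc, hb, one_mul]
      exact hrm' (Ideal.IsPrime.mem_of_pow_mem inferInstance n (this ▸ m.mul_mem_right a ht))
    exact FaithfulSMul.algebraMap_injective _ _
  · intro b
    obtain ⟨b, rfl⟩ := Ideal.Quotient.mk_surjective b
    obtain ⟨n, a, ha⟩ := IsLocalization.Away.surj r b
    obtain ⟨c, hc⟩ := hk.2 (Ideal.Quotient.mk m a)
    refine ⟨c, Ideal.Quotient.eq.mpr ?_⟩
    rw [← Ideal.unit_mul_mem_iff_mem _ (hru.pow n), mul_sub, mul_comm _ b, ha, ← map_pow,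
      IsScalarTower.algebraMap_apply k A B, ← map_mul, ← map_sub]
    apply hmB
    rw [← Ideal.Quotient.eq_zero_iff_mem, map_sub, map_mul, map_pow,
      show Ideal.Quotient.mk m r = 1 from by
        rw [← map_one (Ideal.Quotient.mk m)]; exact Ideal.Quotient.eq.mpr hr,
      one_pow, one_mul, sub_eq_zero]
    exact hc

end LocalParameter

/-! ### The residue field of a henselization -/

section HenselizationResidueField

open IsLocalRing Polynomial

variable {k A A' : Type u} [Field k] [CommRing A] [IsLocalRing A] [CommRing A'] [IsLocalRing A']

/-- The subring of the elements of a local ring whose residue lies in a given subfield is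
henselian if the local ring is. -/
lemma henselianLocalRing_comap_residue (hA' : HenselianLocalRing A') (ψ : k →+* A') :
    IsLocalHom (((residue A').comp ψ).range.comap (residue A')).subtype ∧
      HenselianLocalRing (((residue A').comp ψ).range.comap (residue A')) := by
  set S := ((residue A').comp ψ).range.comap (residue A') with hS
  have hloc : IsLocalHom S.subtype := by
    constructor
    rintro ⟨x, c, hc⟩ hx
    have hc' : (residue A') (ψ c) = residue A' x := hc
    have hx' : IsUnit x := hx
    obtain ⟨y, hy⟩ := hx'.exists_right_inv
    refine IsUnit.of_mul_eq_one (⟨y, c⁻¹, ?_⟩ : S) (Subtype.ext hy)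
    change ((residue A').comp ψ) c⁻¹ = residue A' y
    have h1 : residue A' x * residue A' y = 1 := by rw [← map_mul, hy, map_one]
    rw [map_inv₀]
    exact inv_eq_of_mul_eq_one_right ((congrArg (· * residue A' y) hc').trans h1)
  have : IsLocalRing S := RingHom.domain_isLocalRing S.subtype
  refine ⟨hloc, ⟨fun f hf a₀ h₁ h₂ ↦ ?_⟩⟩
  have hmem (s : S) : s ∈ maximalIdeal S ↔ (s : A') ∈ maximalIdeal A' := by
    rw [mem_maximalIdeal, mem_maximalIdeal, mem_nonunits_iff, mem_nonunits_iff,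
      ← isUnit_map_iff S.subtype s]
    rfl
  obtain ⟨a, ha, ha'⟩ := HenselianLocalRing.is_henselian (f.map S.subtype) (hf.map _) a₀
    (by
      have := (hmem _).mp h₁
      rwa [show ((f.eval a₀ : S) : A') = (f.map S.subtype).eval (a₀ : A') from
        (eval_map_apply S.subtype a₀).symm] at this)
    (by
      have := h₂.map S.subtype
      rw [derivative_map]
      rwa [show S.subtype (f.derivative.eval a₀) = (f.derivative.map S.subtype).eval (a₀ : A') from
        (eval_map_apply S.subtype a₀).symm] at this)
  -- The root has the same residue as the approximate root `a₀`, so it stays in `S`.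
  have haS : a ∈ S := by
    have h : residue A' a = residue A' a₀ := by
      rw [← sub_eq_zero, ← map_sub]
      exact (residue_eq_zero_iff _).mpr ha'
    rw [hS, Subring.mem_comap, h]
    exact a₀.2
  refine ⟨⟨a, haS⟩, ?_, (hmem _).mpr ha'⟩
  apply Subtype.val_injective
  exact (eval_map_apply S.subtype (⟨a, haS⟩ : S)).symm.trans ha

/-- The subring `S` of elements with residue in `k` is henselian and contains the image of `A`. So
`A'` maps to `S`, and by uniqueness the composite `A' ⟶ S ⟶ A'` is the identity; hence `S` is
everything. -/
lemma IsHenselization.surjective_residue {i : A →+* A'} (hi : IsHenselization i) (φ : k →+* A)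
    (hφ : Function.Surjective ((residue A).comp φ)) :
    Function.Surjective ((residue A').comp (i.comp φ)) := by
  have hA' := hi.henselian
  have hloci := hi.isLocalHom
  set S := ((residue A').comp (i.comp φ)).range.comap (residue A') with hS
  obtain ⟨hloc, hhens⟩ : IsLocalHom S.subtype ∧ HenselianLocalRing S :=
    henselianLocalRing_comap_residue hA' (i.comp φ)
  have hiS (a : A) : i a ∈ S := by
    obtain ⟨c, hc⟩ := hφ (residue A a)
    refine ⟨c, ?_⟩
    rw [RingHom.comp_apply, RingHom.comp_apply, ← sub_eq_zero, ← map_sub, ← map_sub,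
      residue_eq_zero_iff]
    have : φ c - a ∈ maximalIdeal A := by
      rw [← residue_eq_zero_iff, map_sub, sub_eq_zero]
      exact hc
    rw [mem_maximalIdeal] at this ⊢
    exact (map_mem_nonunits_iff i _).mpr this
  let v : A →+* S := i.codRestrict S hiS
  have hv : IsLocalHom v := ⟨fun a ha ↦ hloci.map_nonunit a (ha.map S.subtype)⟩
  obtain ⟨w, ⟨hw, hwv⟩, -⟩ := hi.existsUnique_lift S v hv
  have h := (hi.existsUnique_lift A' i hloci).unique
    (y₁ := S.subtype.comp w) (y₂ := RingHom.id A')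
    ⟨RingHom.isLocalHom_comp _ _, by rw [RingHom.comp_assoc, hwv]; rfl⟩
    ⟨⟨fun _ h ↦ h⟩, rfl⟩
  intro y
  obtain ⟨x, rfl⟩ := residue_surjective y
  obtain ⟨c, hc⟩ := (w x).2
  refine ⟨c, hc.trans ?_⟩
  exact congr(residue A' ($h x))

end HenselizationResidueField

/-! ### A local parameter at a closed point of the curve -/

section CurvePoint

variable {k : Type u} [Field k] {C : Scheme.{u}} (c : C ⟶ Spec (.of k))

/-- The scalars in the sections of a `k`-scheme. -/
def scalars (c : C ⟶ Spec (.of k)) (W : C.Opens) : CommRingCat.of k ⟶ Γ(C, W) :=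
  (Scheme.ΓSpecIso (.of k)).inv ≫ c.appLE ⊤ W (show W ≤ c ⁻¹ᵁ ⊤ from le_top)

lemma scalars_map (c : C ⟶ Spec (.of k)) {V W : C.Opens} (h : V ≤ W) :
    scalars c W ≫ C.presheaf.map (homOfLE h).op = scalars c V := by
  rw [scalars, Category.assoc, Scheme.Hom.appLE_map, scalars]

/-- By the Nullstellensatz the residue field at `Q` is `k`, so `exists_local_parameter` applies on a
standard smooth affine neighbourhood; `W` is the locus where its `r` is invertible. -/
theorem exists_affine_local_parameter [IsAlgClosed k] [IsIntegral C] [SmoothOfRelativeDimension 1 c]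
    {Q : C} (hQ : IsClosed ({Q} : Set C)) :
    ∃ (W : C.Opens) (_ : IsAffineOpen W) (_ : Q ∈ W) (t : Γ(C, W)), t ≠ 0 ∧
      Q ∉ C.basicOpen t ∧
      Function.Bijective ((Ideal.Quotient.mk (Ideal.span {t})).comp (scalars c W).hom) := by
  obtain ⟨U, hU, V, hV, hQV, e, hsm⟩ :=
    SmoothOfRelativeDimension.exists_isStandardSmoothOfRelativeDimension (n := 1) (f := c) Q
  obtain rfl : U = ⊤ := eq_top_iff.mpr fun x _ ↦ by
    rw [Subsingleton.elim x (c Q)]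
    exact e hQV
  have : Nonempty V := ⟨⟨Q, hQV⟩⟩
  algebraize [(scalars c V).hom]
  have hsm' : Algebra.IsStandardSmoothOfRelativeDimension 1 k Γ(C, V) :=
    (RingHom.isStandardSmoothOfRelativeDimension_respectsIso (n := 1)).2 _
      (Scheme.ΓSpecIso (.of k)).symm.commRingCatIsoToRingEquiv hsm
  let m := (hV.primeIdealOf ⟨Q, hQV⟩).asIdeal
  have hm : m.IsMaximal := hV.primeIdealOf_isMaximal_of_isClosed ⟨Q, hQV⟩ hQ
  have : Algebra.IsStandardSmooth k Γ(C, V) :=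
    Algebra.IsStandardSmoothOfRelativeDimension.isStandardSmooth 1
  have hk : Function.Bijective (algebraMap k (Γ(C, V) ⧸ m)) := by
    let _ := Ideal.Quotient.field m
    have : Module.Finite k (Γ(C, V) ⧸ m) := finite_of_finite_type_of_isJacobsonRing _ _
    exact IsAlgClosed.algebraMap_bijective_of_isIntegral
  obtain ⟨r, hr, t, htm, ht0, h⟩ := exists_local_parameter m hk
  have hmem (s : Γ(C, V)) : Q ∈ C.basicOpen s ↔ s ∉ m := by
    rw [← PrimeSpectrum.mem_basicOpen, ← hV.fromSpec_preimage_basicOpen]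
    change _ ↔ hV.fromSpec (hV.primeIdealOf ⟨Q, hQV⟩) ∈ C.basicOpen s
    rw [hV.fromSpec_primeIdealOf]
  have hloc := hV.isLocalization_basicOpen r
  have hQW : Q ∈ C.basicOpen r := (hmem r).mpr hr
  let _ : Algebra k Γ(C, C.basicOpen r) := (scalars c (C.basicOpen r)).hom.toAlgebra
  have : IsScalarTower k Γ(C, V) Γ(C, C.basicOpen r) := .of_algebraMap_eq fun x ↦
    congr($(scalars_map c (C.basicOpen_le r)) x).symm
  refine ⟨C.basicOpen r, hV.basicOpen r, hQW, algebraMap Γ(C, V) _ t, ?_, ?_, h _⟩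
  · have : Nonempty (C.basicOpen r) := ⟨⟨Q, hQW⟩⟩
    have hinj := map_injective_of_isIntegral C (homOfLE (C.basicOpen_le r))
    exact fun h0 ↦ ht0 (hinj (h0.trans (map_zero _).symm))
  · intro h
    refine (hmem t).mp ?_ htm
    have h' : Q ∈ C.basicOpen (C.presheaf.map (homOfLE (C.basicOpen_le r)).op t) := h
    rw [Scheme.basicOpen_res] at h'
    exact h'.2

end CurvePoint

/-! ### Gluing sections -/

section SheafUtilities

variable {X Y : Scheme.{u}}

lemma section_ext_of_cover {U : X.Opens} {a b : Γ(X, U)}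
    (h : ∀ x ∈ U, ∃ (V : X.Opens) (hV : V ≤ U), x ∈ V ∧
      X.presheaf.map (homOfLE hV).op a = X.presheaf.map (homOfLE hV).op b) : a = b := by
  choose V hV hxV h using h
  refine TopCat.Sheaf.eq_of_locally_eq' X.sheaf (fun x : U ↦ V x.1 x.2) U
    (fun x ↦ homOfLE (hV x.1 x.2)) ?_ a b (fun x ↦ h x.1 x.2)
  intro x hx
  exact Opens.mem_iSup.mpr ⟨⟨x, hx⟩, hxV x hx⟩

lemma app_map (f : X ⟶ Y) {V W : Y.Opens} (h : W ≤ V) (a : Γ(Y, V)) :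
    f.app W (Y.presheaf.map (homOfLE h).op a) =
      X.presheaf.map (homOfLE (f.preimage_mono h)).op (f.app V a) :=
  congr($(f.naturality (homOfLE h).op) a)

lemma map_map_apply {U V W : X.Opens} (h : V ≤ U) (h' : W ≤ V) (a : Γ(X, U)) :
    X.presheaf.map (homOfLE h').op (X.presheaf.map (homOfLE h).op a) =
      X.presheaf.map (homOfLE (h'.trans h)).op a :=
  congr($(X.presheaf.map_comp (homOfLE h).op (homOfLE h').op) a).symm

/-- Sections which satisfy a condition that determines them glue. -/
lemma exists_section_of_locally {U : X.Opens} (p : ∀ V : X.Opens, Γ(X, V) → Prop)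
    (hres : ∀ V W (h : W ≤ V) a, V ≤ U → p V a → p W (X.presheaf.map (homOfLE h).op a))
    (hinj : ∀ V a b, V ≤ U → p V a → p V b → a = b)
    (hex : ∀ x ∈ U, ∃ V ≤ U, x ∈ V ∧ ∃ a, p V a) :
    ∃ a : Γ(X, U), ∀ x ∈ U, ∃ (V : X.Opens) (hV : V ≤ U), x ∈ V ∧
      p V (X.presheaf.map (homOfLE hV).op a) := by
  choose V hV hxV a ha using hex
  obtain ⟨b, hb, -⟩ := TopCat.Sheaf.existsUnique_gluing' X.sheaf (fun x : U ↦ V x.1 x.2) U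
    (fun x ↦ homOfLE (hV x.1 x.2)) (fun x hx ↦ Opens.mem_iSup.mpr ⟨⟨x, hx⟩, hxV x hx⟩)
    (fun x ↦ a x.1 x.2) (fun x y ↦ hinj _ _ _ (inf_le_left.trans (hV x.1 x.2))
      (hres _ _ inf_le_left _ (hV x.1 x.2) (ha x.1 x.2))
      (hres _ _ inf_le_right _ (hV y.1 y.2) (ha y.1 y.2)))
  refine ⟨b, fun x hx ↦ ⟨V x hx, hV x hx, hxV x hx, ?_⟩⟩
  have h : X.presheaf.map (homOfLE (hV x hx)).op b = a x hx := hb ⟨x, hx⟩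
  rw [h]
  exact ha x hx

/-- Injectivity on all opens makes the local preimages of a section agree on overlaps. -/
lemma isIso_app_of_locally (f : X ⟶ Y) (hinj : ∀ V, Function.Injective (f.app V))
    (hsurj : ∀ (V : Y.Opens) (s : Γ(X, f ⁻¹ᵁ V)), ∀ y ∈ V, ∃ (V' : Y.Opens) (h : V' ≤ V), y ∈ V' ∧
      ∃ b, f.app V' b = X.presheaf.map (homOfLE (f.preimage_mono h)).op s) (V : Y.Opens) :
    IsIso (f.app V) := by
  refine (ConcreteCategory.isIso_iff_bijective _).mpr ⟨hinj V, fun s ↦ ?_⟩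
  obtain ⟨a, ha⟩ := exists_section_of_locally (X := Y) (U := V)
    (fun W b ↦ ∃ h : W ≤ V, f.app W b = X.presheaf.map (homOfLE (f.preimage_mono h)).op s)
    (fun W W' h b _ ⟨h', hb⟩ ↦ ⟨h.trans h', by
      rw [app_map, hb]; exact map_map_apply (f.preimage_mono h') (f.preimage_mono h) s⟩)
    (fun W a b _ ⟨h, ha⟩ ⟨_, hb⟩ ↦ hinj W (ha.trans hb.symm))
    (fun y hy ↦ by
      obtain ⟨V', h, hy', b, hb⟩ := hsurj V s y hy
      exact ⟨V', h, hy', b, h, hb⟩)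
  refine ⟨a, section_ext_of_cover fun x hx ↦ ?_⟩
  obtain ⟨W, hW, hxW, _, h⟩ := ha (f x) hx
  refine ⟨f ⁻¹ᵁ W, f.preimage_mono hW, hxW, ?_⟩
  exact (app_map f hW a).symm.trans h

end SheafUtilities

/-! ### Functions modulo an equation of the base -/

section PushoutAlgebra

variable {R A B P : CommRingCat.{u}} {f : R ⟶ A} {g : R ⟶ B} {i : A ⟶ P} {j : B ⟶ P}

/-- The pushout maps to `A/(f τ)` compatibly with `A`, since `B` is `R/(τ)`. -/
lemma dvd_of_isPushout (h : IsPushout f g i j) (hg : Function.Surjective g) {τ : R}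
    (hτ : RingHom.ker g.hom = Ideal.span {τ}) {x : A} (hx : i x = 0) : f τ ∣ x := by
  let π : A ⟶ CommRingCat.of (A ⧸ Ideal.span {f τ}) := CommRingCat.ofHom (Ideal.Quotient.mk _)
  have hk : RingHom.ker g.hom ≤ RingHom.ker (f ≫ π).hom := by
    rw [hτ, Ideal.span_singleton_le_iff_mem]
    exact Ideal.Quotient.eq_zero_iff_mem.mpr (Ideal.mem_span_singleton_self _)
  let β : B ⟶ CommRingCat.of (A ⧸ Ideal.span {f τ}) :=
    CommRingCat.ofHom (RingHom.liftOfSurjective g.hom hg ⟨(f ≫ π).hom, hk⟩)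
  have hβ : f ≫ π = g ≫ β := by
    ext r
    exact (RingHom.liftOfRightInverse_comp_apply g.hom (Function.surjInv hg)
      (Function.rightInverse_surjInv hg) ⟨(f ≫ π).hom, hk⟩ r).symm
  have h1 := congr($(h.inl_desc π β hβ) x)
  rw [CommRingCat.comp_apply, hx, map_zero] at h1
  exact Ideal.mem_span_singleton.mp (Ideal.Quotient.eq_zero_iff_mem.mp h1.symm)

lemma surjective_of_isPushout (h : IsPushout f g i j) {E : CommRingCat.{u}} (φ : E ⟶ P)
    (hi : ∀ a, ∃ e, φ e = i a) (hj : ∀ b, ∃ e, φ e = j b) : Function.Surjective φ := by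
  let S := CommRingCat.of φ.hom.range
  let i' : A ⟶ S := CommRingCat.ofHom (i.hom.codRestrict φ.hom.range hi)
  let j' : B ⟶ S := CommRingCat.ofHom (j.hom.codRestrict φ.hom.range hj)
  let ι : S ⟶ P := CommRingCat.ofHom φ.hom.range.subtype
  have hw : f ≫ i' = g ≫ j' := by
    ext r
    exact congr($(h.w) r)
  have hid : h.desc i' j' hw ≫ ι = 𝟙 P := by
    apply h.hom_ext
    · rw [h.inl_desc_assoc, Category.comp_id]; rfl
    · rw [h.inr_desc_assoc, Category.comp_id]; rfl
  intro p
  have hp : ι (h.desc i' j' hw p) = p := congr($hid p)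
  obtain ⟨e, he⟩ := (h.desc i' j' hw p).2
  exact ⟨e, he.trans hp⟩

end PushoutAlgebra

section BaseSections

variable {X Y S : Scheme.{u}}

/-- The pullback of global sections of the base, restricted to an open set. -/
def baseSec (p : X ⟶ S) (U : X.Opens) : Γ(S, ⊤) ⟶ Γ(X, U) :=
  p.appLE ⊤ U (show U ≤ p ⁻¹ᵁ ⊤ from le_top)

lemma baseSec_map (p : X ⟶ S) {U V : X.Opens} (h : V ≤ U) (τ : Γ(S, ⊤)) :
    X.presheaf.map (homOfLE h).op (baseSec p U τ) = baseSec p V τ :=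
  congr($(Scheme.Hom.appLE_map (U := ⊤) p (V := U) le_top (homOfLE h).op) τ)

lemma map_app_congr {f f' : X ⟶ Y} (h : f = f') {O : Y.Opens} {U : X.Opens} (hU : U ≤ f ⁻¹ᵁ O)
    (hU' : U ≤ f' ⁻¹ᵁ O) (b : Γ(Y, O)) :
    X.presheaf.map (homOfLE hU).op (f.app O b) =
      X.presheaf.map (homOfLE hU').op (f'.app O b) := by
  subst h
  rfl

lemma app_baseSec (f : X ⟶ Y) (p : Y ⟶ S) (V : Y.Opens) (τ : Γ(S, ⊤)) :
    f.app V (baseSec p V τ) = baseSec (f ≫ p) (f ⁻¹ᵁ V) τ :=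
  app_map f _ (p.appTop τ)

lemma baseSec_comp {T : Scheme.{u}} (p : X ⟶ T) (ι : T ⟶ S) (U : X.Opens) (τ : Γ(S, ⊤)) :
    baseSec (p ≫ ι) U τ = baseSec p U (ι.appTop τ) := rfl

lemma mul_baseSec_injective [IsAffine S] (p : X ⟶ S) [Flat p] {τ : Γ(S, ⊤)}
    (hτ : τ ∈ nonZeroDivisors Γ(S, ⊤)) {U : X.Opens} {a b : Γ(X, U)}
    (h : baseSec p U τ * a = baseSec p U τ * b) : a = b := by
  refine section_ext_of_cover fun x hx ↦ ?_
  obtain ⟨V, hV, hxV, hVU⟩ := Opens.isBasis_iff_nbhd.mp X.isBasis_affineOpens hx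
  refine ⟨V, hVU, hxV, ?_⟩
  have hflat : (baseSec p V).hom.Flat := p.flat_appLE (isAffineOpen_top S) hV _
  algebraize [(baseSec p V).hom]
  have hreg : IsSMulRegular Γ(X, V) τ := Module.Flat.isSMulRegular_of_nonZeroDivisors hτ
  refine hreg (?_ : τ • _ = τ • _)
  have h' := congrArg (X.presheaf.map (homOfLE hVU).op) h
  rw [map_mul, map_mul, baseSec_map] at h'
  rw [Algebra.smul_def, Algebra.smul_def]
  exact h'

variable {X' T : Scheme.{u}}

/-- Locally this is `dvd_of_isPushout`; the local quotients are unique because `τ` is a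
nonzerodivisor on the flat scheme `X`, so they glue. -/
lemma baseSec_dvd_of_app_eq_zero [IsAffine S] [IsAffine T] {p : X ⟶ S} [Flat p] {τ : Γ(S, ⊤)}
    (hτ : τ ∈ nonZeroDivisors Γ(S, ⊤)) {j : X' ⟶ X} {pT : X' ⟶ T} {ι : T ⟶ S}
    (H : IsPullback j pT p ι) (hι : Function.Surjective ι.appTop)
    (hker : RingHom.ker ι.appTop.hom = Ideal.span {τ}) {U : X.Opens} {x : Γ(X, U)}
    (hx : j.app U x = 0) : baseSec p U τ ∣ x := by
  obtain ⟨a, ha⟩ := exists_section_of_locally (X := X) (U := U)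
    (fun V b ↦ ∃ h : V ≤ U, X.presheaf.map (homOfLE h).op x = baseSec p V τ * b)
    (fun V W h b _ ⟨h', hb⟩ ↦ ⟨h.trans h', by
      have := congrArg (X.presheaf.map (homOfLE h).op) hb
      rw [map_mul, baseSec_map] at this
      exact (map_map_apply h' h x).symm.trans this⟩)
    (fun V a b _ ⟨_, ha⟩ ⟨_, hb⟩ ↦ mul_baseSec_injective p hτ (ha.symm.trans hb))
    (fun y hy ↦ by
      obtain ⟨V, hV, hyV, hVU⟩ := Opens.isBasis_iff_nbhd.mp X.isBasis_affineOpens hy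
      refine ⟨V, hVU, hyV, ?_⟩
      have hpo := (isIso_pushoutSection_iff H (US := ⊤) (UT := ⊤) (UX := V) (UY := j ⁻¹ᵁ V)
        le_top le_top (by simp)).mp (isIso_pushoutSection_of_isAffineOpen H _ _ _
          (isAffineOpen_top S) (isAffineOpen_top T) hV)
      have hT : ι.appLE ⊤ ⊤ le_top = ι.appTop := Scheme.Hom.appLE_eq_app ι
      rw [Scheme.Hom.appLE_eq_app, hT] at hpo
      obtain ⟨b, hb⟩ := dvd_of_isPushout hpo hι hker
        (x := X.presheaf.map (homOfLE hVU).op x) (by rw [app_map, hx, map_zero])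
      exact ⟨b, hVU, hb⟩)
  refine ⟨a, section_ext_of_cover fun y hy ↦ ?_⟩
  obtain ⟨V, hV, hyV, _, h⟩ := ha y hy
  refine ⟨V, hV, hyV, ?_⟩
  rw [map_mul, baseSec_map]
  exact h

end BaseSections

/-! ### The direct image of the structure sheaf over a truncation -/

section TruncatedPushforward

variable {X Y S T X' Y' : Scheme.{u}} [IsAffine T]
  {pX : X ⟶ S} {pY : Y ⟶ S} {g : X ⟶ Y} {ι : T ⟶ S} {jX : X' ⟶ X} {g' : X' ⟶ Y'} {jY : Y' ⟶ Y}
  {pY' : Y' ⟶ T}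

/-- Lift a section of the kernel to `b` on `Y`. Its pullback to `X` is `τ` times some `c`, and `c`
comes from `Y`, so `b` is divisible by `τ` and vanishes on `Y'`. -/
lemma app_injective_of_isPullback [IsAffine S] (hg : g ≫ pY = pX) (HY : IsPullback jY pY' pY ι)
    (HX : IsPullback jX g' g jY) (hgO : ∀ V, IsIso (g.app V)) [Flat pX] [IsClosedImmersion jY]
    {τ : Γ(S, ⊤)} (hτ : τ ∈ nonZeroDivisors Γ(S, ⊤)) (hι : Function.Surjective ι.appTop)
    (hker : RingHom.ker ι.appTop.hom = Ideal.span {τ}) (V' : Y'.Opens) :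
    Function.Injective (g'.app V') := by
  subst hg
  have HT : IsPullback jX (g' ≫ pY') (g ≫ pY) ι := HX.flip.paste_horiz HY.flip |>.flip
  have key (V : Y.Opens) (hV : IsAffineOpen V) (a : Γ(Y', jY ⁻¹ᵁ V)) (ha : g'.app _ a = 0) :
      a = 0 := by
    obtain ⟨b, rfl⟩ := jY.app_surjective V hV a
    have h0 : jX.app (g ⁻¹ᵁ V) (g.app V b) = 0 := by
      have e1 : (jX ≫ g).app V b = 0 ↔ (g' ≫ jY).app V b = 0 := by rw [HX.w]
      rw [Scheme.Hom.comp_app, Scheme.Hom.comp_app] at e1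
      exact e1.mpr ha
    obtain ⟨c, hc⟩ := baseSec_dvd_of_app_eq_zero hτ HT hι hker h0
    obtain ⟨d, rfl⟩ := ((ConcreteCategory.isIso_iff_bijective _).mp (hgO V)).2 c
    rw [← app_baseSec, ← map_mul] at hc
    rw [((ConcreteCategory.isIso_iff_bijective _).mp (hgO V)).1 hc, map_mul, app_baseSec, HY.w,
      baseSec_comp]
    have hτ0 : ι.appTop τ = 0 := by
      rw [← RingHom.mem_ker, hker]
      exact Ideal.mem_span_singleton_self τ
    rw [hτ0, map_zero, zero_mul]
  rw [injective_iff_map_eq_zero]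
  intro a ha
  refine section_ext_of_cover fun y hy ↦ ?_
  obtain ⟨V₀, hV₀⟩ : ∃ V₀ : Y.Opens, jY ⁻¹ᵁ V₀ = V' := by
    obtain ⟨s, hs, h⟩ := jY.isClosedEmbedding.isInducing.isOpen_iff.mp V'.isOpen
    exact ⟨⟨s, hs⟩, Opens.ext h⟩
  subst hV₀
  obtain ⟨V, hV, hyV, hVV⟩ := Opens.isBasis_iff_nbhd.mp Y.isBasis_affineOpens
    (show jY y ∈ V₀ from hy)
  refine ⟨jY ⁻¹ᵁ V, jY.preimage_mono hVV, hyV, ?_⟩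
  rw [map_zero]
  exact key V hV _ (by rw [app_map, ha, map_zero])

variable {K X₀ : Scheme.{u}} [IsAffine K] {x₀ : X₀ ⟶ K} {s : S ⟶ K} {pr : X ⟶ X₀}

/-- By flat base change the functions on `P × T` are generated by those of `P` and of `T`; the
former lift through `pr`, the latter through `ι`. -/
lemma exists_section_lift (HT : IsPullback jX (g' ≫ pY') pX ι) (H : IsPullback pr pX x₀ s)
    (hι : Function.Surjective ι.appTop) [Flat (ι ≫ s)] (P : X₀.Opens) (hP : IsCompact (P : Set X₀))
    (hP' : IsQuasiSeparated (P : Set X₀)) :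
    Function.Surjective (jX.app (pr ⁻¹ᵁ P)) := by
  have HP : IsPullback (jX ≫ pr) (g' ≫ pY') x₀ (ι ≫ s) := HT.paste_horiz H
  have hpo := (isIso_pushoutSection_iff HP (US := ⊤) (UT := ⊤) (UX := P)
    (UY := (jX ≫ pr) ⁻¹ᵁ P) le_top le_top (by simp)).mp
      (isIso_pushoutSection_of_isQuasiSeparated_of_flat_right HP _ _ _
        (isAffineOpen_top K) (isAffineOpen_top T) hP hP')
  refine surjective_of_isPushout hpo (jX.app (pr ⁻¹ᵁ P)) (fun a ↦ ⟨pr.app P a, ?_⟩) (fun b ↦ ?_)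
  · rw [Scheme.Hom.appLE_eq_app]; rfl
  · obtain ⟨c, rfl⟩ := hι b
    refine ⟨baseSec pX _ c, ?_⟩
    refine (app_baseSec jX pX _ c).trans ?_
    rw [HT.w]
    rfl

theorem isIso_app_of_isPullback [IsAffine S] (hg : g ≫ pY = pX) (HY : IsPullback jY pY' pY ι)
    (HX : IsPullback jX g' g jY) (hgO : ∀ V, IsIso (g.app V)) (hcl : IsClosedMap g)
    [IsClosedImmersion jY] [QuasiCompact g']
    {τ : Γ(S, ⊤)} (hτ : τ ∈ nonZeroDivisors Γ(S, ⊤)) (hι : Function.Surjective ι.appTop)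
    (hker : RingHom.ker ι.appTop.hom = Ideal.span {τ})
    (H : IsPullback pr pX x₀ s) [Flat x₀] [Flat (ι ≫ s)] [QuasiSeparated x₀]
    (hopen : ∀ P' : X'.Opens, ∃ P : X₀.Opens, (jX ≫ pr) ⁻¹ᵁ P = P')
    (hsurj : Function.Surjective (jX ≫ pr)) (V : Y'.Opens) : IsIso (g'.app V) := by
  have : Flat pX := MorphismProperty.of_isPullback (P := @Flat) H inferInstance
  have HT : IsPullback jX (g' ≫ pY') pX ι := by
    subst hg
    exact HX.flip.paste_horiz HY.flip |>.flip
  refine isIso_app_of_locally g' (app_injective_of_isPullback hg HY HX hgO hτ hι hker) ?_ V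
  intro V s' y hy
  obtain ⟨W, hW, hyW, hWV⟩ := Opens.isBasis_iff_nbhd.mp Y'.isBasis_affineOpens hy
  obtain ⟨P, hP⟩ := hopen (g' ⁻¹ᵁ W)
  have hWc : IsCompact (g' ⁻¹ᵁ W : Set X') :=
    QuasiCompact.isCompact_preimage _ W.isOpen hW.isCompact
  have hPc : IsCompact (P : Set X₀) := by
    rw [← hP] at hWc
    have := hWc.image (jX ≫ pr).continuous
    rwa [show ((jX ≫ pr) '' ((jX ≫ pr) ⁻¹ᵁ P : Set X')) = P from
      Set.image_preimage_eq _ hsurj] at this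
  have : QuasiSeparatedSpace X₀ := (quasiSeparated_iff_quasiSeparatedSpace x₀).mp inferInstance
  have hPq : IsQuasiSeparated (P : Set X₀) := IsQuasiSeparated.of_quasiSeparatedSpace _
  have hle : jX ⁻¹ᵁ pr ⁻¹ᵁ P ≤ g' ⁻¹ᵁ V := hP.le.trans (g'.preimage_mono hWV)
  obtain ⟨σ, hσ⟩ := exists_section_lift HT H hι P hPc hPq (X'.presheaf.map (homOfLE hle).op s')
  -- The largest open set of `Y` whose preimage lies in `pr ⁻¹ᵁ P`; it is open because `g` is
  -- closed. The lift `σ` descends to it.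
  let O : Y.Opens := ⟨(g '' (pr ⁻¹ᵁ P : Set X)ᶜ)ᶜ,
    (hcl _ (pr ⁻¹ᵁ P).isOpen.isClosed_compl).isOpen_compl⟩
  -- Points of `X` over `jY y` come from points of `X'` over `y`, which lie in `g' ⁻¹ᵁ W`, the
  -- preimage of `P`.
  have hyO : jY y ∈ O := by
    rintro ⟨x, hx, hxy⟩
    obtain ⟨x', rfl, hx'⟩ := Scheme.exists_preimage_of_isPullback HX x y hxy
    apply hx
    have : x' ∈ g' ⁻¹ᵁ W := by
      change g' x' ∈ W
      rwa [hx']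
    rw [← hP] at this
    exact this
  have hgO' : g ⁻¹ᵁ O ≤ pr ⁻¹ᵁ P := by
    intro x hx
    by_contra h
    exact hx ⟨x, h, rfl⟩
  obtain ⟨b, hb⟩ := ((ConcreteCategory.isIso_iff_bijective _).mp (hgO O)).2
    (X.presheaf.map (homOfLE hgO').op σ)
  refine ⟨jY ⁻¹ᵁ O ⊓ W, inf_le_right.trans hWV, ⟨hyO, hyW⟩,
    Y'.presheaf.map (homOfLE inf_le_left).op (jY.app O b), ?_⟩
  rw [app_map]
  have hU : g' ⁻¹ᵁ (jY ⁻¹ᵁ O ⊓ W) ≤ jX ⁻¹ᵁ g ⁻¹ᵁ O := by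
    change _ ≤ (jX ≫ g) ⁻¹ᵁ O
    rw [HX.w]
    exact g'.preimage_mono inf_le_left
  refine (map_app_congr HX.w.symm (g'.preimage_mono inf_le_left) hU b).trans ?_
  change X'.presheaf.map _ (jX.app _ (g.app O b)) = _
  rw [hb, app_map, hσ]
  refine (map_map_apply (jX.preimage_mono hgO') hU _).trans ?_
  exact map_map_apply hle (hU.trans (jX.preimage_mono hgO')) s'

end TruncatedPushforward

/-! ### Products with a thickened point -/

section ThickPoint

variable {Y Z T K : Scheme.{u}} {q : Y ⟶ Z} {p : Y ⟶ T} {z : Z ⟶ K} {t : T ⟶ K} {ρ : K ⟶ T}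

/-- The section of `Z ×_K T ⟶ Z` that a `K`-point of `T` induces. -/
lemma exists_section_of_isPullback (H : IsPullback q p z t) (hρ : ρ ≫ t = 𝟙 K) :
    ∃ σ : Z ⟶ Y, σ ≫ q = 𝟙 Z ∧ σ ≫ p = z ≫ ρ ∧ IsPullback σ z p ρ := by
  have hw : 𝟙 Z ≫ z = (z ≫ ρ) ≫ t := by rw [Category.assoc, hρ, Category.id_comp, Category.comp_id]
  refine ⟨H.lift (𝟙 Z) (z ≫ ρ) hw, H.lift_fst _ _ _, H.lift_snd _ _ _, ?_⟩
  refine IsPullback.of_right ?_ (H.lift_snd _ _ _) H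
  rw [H.lift_fst, hρ]
  exact IsPullback.of_horiz_isIso ⟨by simp⟩

/-- A surjective section is inverse to `q` on points. -/
lemma exists_preimage_eq_of_section {σ : Z ⟶ Y} (hσ : σ ≫ q = 𝟙 Z) (hs : Function.Surjective σ)
    (W : Y.Opens) : ∃ V : Z.Opens, q ⁻¹ᵁ V = W := by
  refine ⟨σ ⁻¹ᵁ W, ?_⟩
  ext y
  obtain ⟨z, rfl⟩ := hs y
  have : q (σ z) = z := congr($hσ z)
  change σ (q (σ z)) ∈ W ↔ σ z ∈ W
  rw [this]

lemma surjective_of_section {σ : Z ⟶ Y} (hσ : σ ≫ q = 𝟙 Z) : Function.Surjective q :=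
  fun z ↦ ⟨σ z, congr($hσ z)⟩

variable {k B : Type u} [Field k] [CommRing B]

lemma surjective_specMap_of_isNilpotent (ρ : B →+* k) (hs : Function.Surjective ρ)
    (hn : ∀ b, ρ b = 0 → IsNilpotent b) :
    Surjective (Spec.map (CommRingCat.ofHom ρ)) := by
  refine ⟨fun P ↦ ?_⟩
  obtain ⟨P', hP'⟩ : P ∈ Set.range (PrimeSpectrum.comap ρ) := by
    rw [range_comap_of_surjective _ ρ hs]
    exact fun b hb ↦ nilpotent_iff_mem_prime.mp (hn b hb) _ P.2
  exact ⟨P', hP'⟩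

end ThickPoint

/-! ### Flat base change of the direct image -/

section AppIso

variable {X Y : Scheme.{u}}

lemma isIso_app_of_basis (f : X ⟶ Y) {ι : Type*} {B : ι → Y.Opens}
    (hB : Opens.IsBasis (Set.range B)) (h : ∀ i, IsIso (f.app (B i))) (V : Y.Opens) :
    IsIso (f.app V) := by
  have hb i := (ConcreteCategory.isIso_iff_bijective _).mp (h i)
  refine isIso_app_of_locally f (fun V ↦ ?_) (fun V s y hy ↦ ?_) V
  · rw [injective_iff_map_eq_zero]
    intro a ha
    refine section_ext_of_cover fun y hy ↦ ?_
    obtain ⟨_, ⟨i, rfl⟩, hyi, hi⟩ := Opens.isBasis_iff_nbhd.mp hB hy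
    refine ⟨B i, hi, hyi, (hb i).1 ?_⟩
    rw [app_map, app_map, ha, map_zero, map_zero, map_zero]
  · obtain ⟨_, ⟨i, rfl⟩, hyi, hi⟩ := Opens.isBasis_iff_nbhd.mp hB hy
    exact ⟨B i, hi, hyi, (hb i).2 _⟩

lemma isIso_of_isPushout {R A B P A' P' : CommRingCat.{u}} {f : R ⟶ A} {g : R ⟶ B} {i : A ⟶ P}
    {j : B ⟶ P} {f' : R ⟶ A'} {i' : A' ⟶ P'} {j' : B ⟶ P'} (h : IsPushout f g i j)
    (h' : IsPushout f' g i' j') (e : A ⟶ A') [IsIso e] (he : f ≫ e = f') (θ : P ⟶ P')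
    (hi : i ≫ θ = e ≫ i') (hj : j ≫ θ = j') : IsIso θ := by
  have h'' : IsPushout f g (e ≫ i') j' :=
    h'.of_iso (Iso.refl _) (asIso e).symm (Iso.refl _) (Iso.refl _) (by simp [← he]) (by simp)
      (by simp) (by simp)
  have : θ = (h.isoIsPushout _ _ h'').hom := by
    apply h.hom_ext
    · simp [hi]
    · simp [hj]
  rw [this]
  infer_instance

/-- Flat base change along a thickening of a point of a morphism under which the structure sheaf
is the direct image of the structure sheaf. -/
lemma isIso_app_of_isPullback_thickening {X' Y' T K : Scheme.{u}} [IsAffine T] [IsAffine K]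
    {f : X ⟶ Y} {f' : X' ⟶ Y'} {qX : X' ⟶ X} {q : Y' ⟶ Y} {y : Y ⟶ K} {p : Y' ⟶ T} {t : T ⟶ K}
    (HX : IsPullback qX f' f q) (H : IsPullback q p y t) [Flat t] [QuasiCompact f]
    [QuasiSeparated f] (hf : ∀ V, IsIso (f.app V))
    (hq : ∀ W : Y'.Opens, ∃ V : Y.Opens, q ⁻¹ᵁ V = W) (W : Y'.Opens) : IsIso (f'.app W) := by
  refine isIso_app_of_basis f' (isBasis_preimage_affineOpens hq) (fun V ↦ ?_) W
  have HT : IsPullback qX (f' ≫ p) (f ≫ y) t := HX.paste_vert H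
  have hU : f' ⁻¹ᵁ q ⁻¹ᵁ V.1 = qX ⁻¹ᵁ f ⁻¹ᵁ V.1 := by
    rw [← Scheme.Hom.comp_preimage, ← Scheme.Hom.comp_preimage, HX.w]
  have h₁ := isPushout_sections_of_isPullback H V
  have h₂ := (isIso_pushoutSection_iff HT (US := ⊤) (UT := ⊤) (UX := f ⁻¹ᵁ V.1)
    (UY := f' ⁻¹ᵁ q ⁻¹ᵁ V.1) le_top le_top (by simpa using hU)).mp
      (isIso_pushoutSection_of_isQuasiSeparated_of_flat_right HT _ _ _
        (isAffineOpen_top K) (isAffineOpen_top T)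
        (QuasiCompact.isCompact_preimage _ V.1.isOpen V.2.isCompact)
        (f.isQuasiSeparated_preimage V.2.isQuasiSeparated))
  have ht : t.appLE ⊤ ⊤ le_top = t.appTop := Scheme.Hom.appLE_eq_app t
  rw [ht] at h₂
  have := hf V.1
  have hw : qX ≫ f = f' ≫ q := HX.w
  -- Over `q ⁻¹ᵁ V` the map is `f.app V` tensored with the ring of `T`.
  refine isIso_of_isPushout h₁ h₂ (f.app V.1) ?_ (f'.app (q ⁻¹ᵁ V.1)) ?_ ?_
  · rw [Scheme.Hom.app_eq_appLE]
    exact Scheme.Hom.appLE_comp_appLE ..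
  · simp only [Scheme.Hom.app_eq_appLE, Scheme.Hom.appLE_comp_appLE, hw]
  · rw [Scheme.Hom.app_eq_appLE]
    exact Scheme.Hom.appLE_comp_appLE ..

end AppIso

/-! ### Triviality over a thickened point -/

section Thickening

variable {X Y X₀ S T K X₁ Y₁ X' Y' : Scheme.{u}} {pX : X ⟶ S} {pY : Y ⟶ S} {g : X ⟶ Y}
  {ι : T ⟶ S} {s : S ⟶ K} {ρ : K ⟶ T} {pr : X ⟶ X₀} {x₀ : X₀ ⟶ K}
  {jY₁ : Y₁ ⟶ Y} {y₁ : Y₁ ⟶ K} {jX₁ : X₁ ⟶ X} {g₁ : X₁ ⟶ Y₁}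
  {jY : Y' ⟶ Y} {pY' : Y' ⟶ T} {jX : X' ⟶ X} {g' : X' ⟶ Y'}

lemma exists_homeomorph_of_surjective {A B Z : Scheme.{u}} (α : Z ⟶ A) (β : Z ⟶ B)
    [IsClosedImmersion α] [IsClosedImmersion β] [Surjective α] [Surjective β] :
    ∃ φ : A ≃ₜ B, ∀ z, φ (α z) = β z := by
  let a := α.isClosedEmbedding.isEmbedding.toHomeomorphOfSurjective α.surjective
  let b := β.isClosedEmbedding.isEmbedding.toHomeomorphOfSurjective β.surjective
  refine ⟨a.symm.trans b, fun z ↦ ?_⟩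
  change b (a.symm (a z)) = b z
  rw [a.symm_apply_apply]

/-- A family over a thickening `T` of a point `K` is the base change of its fibre, if it receives
a morphism from a trivial family under which the structure sheaf is the direct image of the
structure sheaf, both over the thickening and over the point. -/
theorem exists_isPullback_of_thickening [IsAffine T] [IsAffine K] (hg : g ≫ pY = pX)
    (H : IsPullback pr pX x₀ s) (hρ : ρ ≫ ι ≫ s = 𝟙 K) [IsClosedImmersion ρ] [Surjective ρ]
    [Flat (ι ≫ s)] [QuasiCompact g] [QuasiSeparated g]
    (HY₁ : IsPullback jY₁ y₁ pY (ρ ≫ ι)) (HX₁ : IsPullback jX₁ g₁ g jY₁)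
    (hg₁ : ∀ V, IsIso (g₁.app V))
    (HY : IsPullback jY pY' pY ι) (HX : IsPullback jX g' g jY) (hg' : ∀ V, IsIso (g'.app V)) :
    ∃ θ : Y' ⟶ Y₁, IsPullback θ pY' y₁ (ι ≫ s) := by
  have HT₁ : IsPullback (jX₁ ≫ pr) (g₁ ≫ y₁) x₀ (𝟙 K) := by
    have h := (HX₁.paste_vert HY₁).paste_horiz (hg ▸ H)
    rwa [Category.assoc, hρ] at h
  have HT : IsPullback (jX ≫ pr) (g' ≫ pY') x₀ (ι ≫ s) :=
    (HX.paste_vert HY).paste_horiz (hg ▸ H)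
  have : IsIso (jX₁ ≫ pr) := HT₁.isIso_fst_of_isIso
  have : QuasiCompact g₁ := MorphismProperty.of_isPullback (P := @QuasiCompact) HX₁ inferInstance
  have : QuasiSeparated g₁ :=
    MorphismProperty.of_isPullback (P := @QuasiSeparated) HX₁ inferInstance
  -- The fibre of `g`, with `X₁` identified with `X₀`. Its product with `T` is the morphism `b`
  -- below.
  obtain ⟨f, hf⟩ : ∃ f, f = inv (jX₁ ≫ pr) ≫ g₁ := ⟨_, rfl⟩
  have hfO V : IsIso (f.app V) := by
    have := hg₁ V
    rw [hf, Scheme.Hom.comp_app]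
    have h : IsIso ((inv (jX₁ ≫ pr)).app (g₁ ⁻¹ᵁ V)) := inferInstance
    exact @IsIso.comp_isIso _ _ _ _ _ _ _ this h
  have hfc : QuasiCompact f := hf ▸ inferInstance
  have hfs : QuasiSeparated f := hf ▸ inferInstance
  have hfy : f ≫ y₁ = x₀ := by
    rw [hf, Category.assoc, IsIso.inv_comp_eq, HT₁.w, Category.comp_id]
  have HB : IsPullback (pullback.fst y₁ (ι ≫ s)) (pullback.snd y₁ (ι ≫ s)) y₁ (ι ≫ s) :=
    .of_hasPullback _ _
  obtain ⟨b, hb₁, hb₂⟩ : ∃ b : X' ⟶ pullback y₁ (ι ≫ s),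
      b ≫ pullback.fst _ _ = (jX ≫ pr) ≫ f ∧ b ≫ pullback.snd _ _ = g' ≫ pY' :=
    ⟨_, pullback.lift_fst _ _ (by rw [Category.assoc, hfy, HT.w]), pullback.lift_snd _ _ _⟩
  have Hb : IsPullback (jX ≫ pr) b f (pullback.fst y₁ (ι ≫ s)) :=
    .of_bot (by rwa [hfy, hb₂]) hb₁.symm HB
  obtain ⟨β, hβ₁, hβ₂, Hβ⟩ := exists_section_of_isPullback HB hρ
  have : Surjective β := MorphismProperty.of_isPullback (P := @Surjective) Hβ.flip inferInstance
  have : IsClosedImmersion β :=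
    MorphismProperty.of_isPullback (P := @IsClosedImmersion) Hβ.flip inferInstance
  obtain ⟨α, hα₁, hα₂⟩ : ∃ α : Y₁ ⟶ Y', α ≫ jY = jY₁ ∧ α ≫ pY' = y₁ ≫ ρ :=
    ⟨_, HY.lift_fst _ _ (by rw [HY₁.w, Category.assoc]), HY.lift_snd _ _ _⟩
  -- `Y₁` is the fibre over the point `ρ` of both `Y'` and `Y₁ ×_K T`, and `α`, `β` are
  -- homeomorphisms onto these.
  have Hα : IsPullback α y₁ pY' ρ := .of_right (by rwa [hα₁]) hα₂ HY
  have : Surjective α := MorphismProperty.of_isPullback (P := @Surjective) Hα.flip inferInstance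
  have : IsClosedImmersion α :=
    MorphismProperty.of_isPullback (P := @IsClosedImmersion) Hα.flip inferInstance
  -- `v` embeds `X₀` in `X'` and hits every point, so `g'` and `b` can be compared on points after
  -- `v`, where both become `f`.
  obtain ⟨v, hv₁, hv₂, Hv⟩ := exists_section_of_isPullback HT hρ
  have : Surjective v := MorphismProperty.of_isPullback (P := @Surjective) Hv.flip inferInstance
  have hvj : v ≫ jX = inv (jX₁ ≫ pr) ≫ jX₁ := by
    apply H.hom_ext
    · rw [Category.assoc, hv₁, Category.assoc, IsIso.inv_hom_id]
    · rw [← hg, Category.assoc, reassoc_of% HX.w, HY.w, reassoc_of% hv₂,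
        Category.assoc, reassoc_of% HX₁.w, HY₁.w, ← hfy, hf, Category.assoc, Category.assoc]
  have hvα : v ≫ g' = f ≫ α := by
    apply HY.hom_ext
    · rw [Category.assoc, ← HX.w, reassoc_of% hvj, Category.assoc, hα₁, hf, Category.assoc, HX₁.w]
    · rw [Category.assoc, hv₂, Category.assoc, hα₂, reassoc_of% hfy]
  have hvβ : v ≫ b = f ≫ β := by
    apply HB.hom_ext
    · rw [Category.assoc, hb₁, Category.assoc, reassoc_of% hv₁, Category.assoc, hβ₁, Category.comp_id]
    · rw [Category.assoc, hb₂, hv₂, Category.assoc, hβ₂, reassoc_of% hfy]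
  obtain ⟨φ, hφ⟩ := exists_homeomorph_of_surjective α β
  obtain ⟨e, he⟩ := exists_iso_of_isIso_app g' b hg'
    (isIso_app_of_isPullback_thickening Hb HB hfO
      (exists_preimage_eq_of_section hβ₁ β.surjective)) φ fun x ↦ by
      obtain ⟨x, rfl⟩ := v.surjective x
      rw [← Scheme.Hom.comp_apply, hvα, ← Scheme.Hom.comp_apply, hvβ]
      exact hφ _
  have hp : e.hom ≫ pullback.snd _ _ = pY' := by
    have h : g' ≫ e.hom ≫ pullback.snd _ _ = g' ≫ pY' := by rw [reassoc_of% he, hb₂]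
    have := hg' ⊤
    -- A morphism to the affine scheme `T` is determined on global sections, where `g'` is an
    -- isomorphism and can be cancelled.
    refine ext_of_isAffine ?_
    have h' := congr(Scheme.Hom.appTop $h)
    rw [Scheme.Hom.comp_appTop, Scheme.Hom.comp_appTop] at h'
    have : Mono g'.appTop := by
      have : IsIso g'.appTop := hg' ⊤
      infer_instance
    exact (cancel_mono _).mp h'
  refine ⟨e.hom ≫ pullback.fst _ _, ?_⟩
  exact IsPullback.of_iso HB e.symm (Iso.refl _) (Iso.refl _) (Iso.refl _) (by simp) (by simp [← hp])
    (by simp) (by simp)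

end Thickening

/-! ### Affine bases and their truncations -/

section SpecThickening

variable {k A B : Type u} [Field k] [CommRing A] [CommRing B]

lemma surjective_appTop_specMap {π : A →+* B} (hπ : Function.Surjective π) :
    Function.Surjective (Spec.map (CommRingCat.ofHom π)).appTop := by
  intro b
  obtain ⟨a, ha⟩ := hπ ((Scheme.ΓSpecIso (.of B)).hom b)
  refine ⟨(Scheme.ΓSpecIso (.of A)).inv a, ?_⟩
  have h := congr($(Scheme.ΓSpecIso_inv_naturality (CommRingCat.ofHom π)) a)
  refine h.symm.trans ?_
  change (Scheme.ΓSpecIso (.of B)).inv (π a) = b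
  rw [ha, ← CommRingCat.comp_apply, Iso.hom_inv_id]
  rfl

lemma ker_appTop_specMap {π : A →+* B} {τ : A} (hker : RingHom.ker π = Ideal.span {τ}) :
    RingHom.ker (Spec.map (CommRingCat.ofHom π)).appTop.hom =
      Ideal.span {(Scheme.ΓSpecIso (.of A)).inv τ} := by
  ext x
  have h := congr($(Scheme.ΓSpecIso_naturality (CommRingCat.ofHom π)) x)
  have hA (x) : (Scheme.ΓSpecIso (.of A)).inv ((Scheme.ΓSpecIso (.of A)).hom x) = x :=
    congr($((Scheme.ΓSpecIso (.of A)).hom_inv_id) x)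
  have hA' (x) : (Scheme.ΓSpecIso (.of A)).hom ((Scheme.ΓSpecIso (.of A)).inv x) = x :=
    congr($((Scheme.ΓSpecIso (.of A)).inv_hom_id) x)
  have hB (x) : (Scheme.ΓSpecIso (.of B)).inv ((Scheme.ΓSpecIso (.of B)).hom x) = x :=
    congr($((Scheme.ΓSpecIso (.of B)).hom_inv_id) x)
  change (Scheme.ΓSpecIso (.of B)).hom ((Spec.map (CommRingCat.ofHom π)).appTop x) =
    π ((Scheme.ΓSpecIso (.of A)).hom x) at h
  have h1 : (Spec.map (CommRingCat.ofHom π)).appTop x = 0 ↔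
      (Scheme.ΓSpecIso (.of A)).hom x ∈ RingHom.ker π := by
    rw [RingHom.mem_ker, ← h]
    exact ⟨fun h ↦ by rw [h, map_zero], fun h ↦ (hB _).symm.trans (by rw [h, map_zero])⟩
  rw [RingHom.mem_ker]
  refine h1.trans ?_
  rw [hker, Ideal.mem_span_singleton, Ideal.mem_span_singleton]
  refine ⟨fun h ↦ ?_, fun h ↦ ?_⟩
  · have := map_dvd (Scheme.ΓSpecIso (.of A)).inv.hom h
    exact hA x ▸ this
  · have := map_dvd (Scheme.ΓSpecIso (.of A)).hom.hom h
    exact hA' τ ▸ this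

variable {X Y X₀ X' Y' : Scheme.{u}} {pX : X ⟶ Spec (.of A)} {pY : Y ⟶ Spec (.of A)} {g : X ⟶ Y}
  {K : Scheme.{u}} {s : Spec (.of A) ⟶ K} {r : K ⟶ Spec (.of B)} {pr : X ⟶ X₀} {x₀ : X₀ ⟶ K}
  {π : A →+* B} {jY : Y' ⟶ Y} {pY' : Y' ⟶ Spec (.of B)} {jX : X' ⟶ X} {g' : X' ⟶ Y'}

lemma isIso_app_of_isPullback_specMap [IsAffine K] (hg : g ≫ pY = pX) (H : IsPullback pr pX x₀ s)
    (hgO : ∀ V, IsIso (g.app V)) (hcl : IsClosedMap g) [QuasiCompact g] [Flat x₀]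
    [QuasiSeparated x₀] {τ : A} (hτ : τ ∈ nonZeroDivisors A) (hπ : Function.Surjective π)
    (hker : RingHom.ker π = Ideal.span {τ}) [Surjective r]
    (hr : r ≫ Spec.map (CommRingCat.ofHom π) ≫ s = 𝟙 K)
    [Flat (Spec.map (CommRingCat.ofHom π) ≫ s)]
    (HY : IsPullback jY pY' pY (Spec.map (CommRingCat.ofHom π))) (HX : IsPullback jX g' g jY)
    (V : Y'.Opens) : IsIso (g'.app V) := by
  have : IsClosedImmersion (Spec.map (CommRingCat.ofHom π)) :=
    IsClosedImmersion.spec_of_surjective _ hπ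
  have : IsClosedImmersion jY :=
    MorphismProperty.of_isPullback (P := @IsClosedImmersion) HY.flip inferInstance
  have : QuasiCompact g' := MorphismProperty.of_isPullback (P := @QuasiCompact) HX inferInstance
  have HT : IsPullback (jX ≫ pr) (g' ≫ pY') x₀ (Spec.map (CommRingCat.ofHom π) ≫ s) :=
    (HX.paste_vert HY).paste_horiz (hg ▸ H)
  obtain ⟨v, hv₁, hv₂, Hv⟩ := exists_section_of_isPullback HT hr
  have : Surjective v := MorphismProperty.of_isPullback (P := @Surjective) Hv.flip inferInstance
  have hτ' : (Scheme.ΓSpecIso (.of A)).inv τ ∈ nonZeroDivisors Γ(Spec (.of A), ⊤) := by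
    have hi := (ConcreteCategory.isIso_iff_bijective (Scheme.ΓSpecIso (.of A)).hom).mp inferInstance
    rw [mem_nonZeroDivisors_iff_right] at hτ ⊢
    intro x hx
    refine hi.1 ?_
    rw [map_zero]
    refine hτ _ ?_
    have := congr((Scheme.ΓSpecIso (.of A)).hom $hx)
    rw [map_mul, map_zero] at this
    refine Eq.trans ?_ this
    congr 1
    exact congr($((Scheme.ΓSpecIso (.of A)).inv_hom_id.symm) τ)
  exact isIso_app_of_isPullback hg HY HX hgO hcl hτ' (surjective_appTop_specMap hπ)
    (ker_appTop_specMap hker) H (exists_preimage_eq_of_section hv₁ v.surjective)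
    (surjective_of_section hv₁) V

end SpecThickening

section Truncation

variable {k A : Type u} [Field k] [CommRing A]
variable {X Y X₀ X' Y' Y₁ : Scheme.{u}} {pX : X ⟶ Spec (.of A)} {pY : Y ⟶ Spec (.of A)} {g : X ⟶ Y}
  {φ : k →+* A} {ρ : A →+* k} {t : A} {m : ℕ} {pr : X ⟶ X₀} {x₀ : X₀ ⟶ Spec (.of k)}
  {jY : Y' ⟶ Y} {pY' : Y' ⟶ Spec (.of (A ⧸ Ideal.span {t ^ m}))}
  {jY₁ : Y₁ ⟶ Y} {y₁ : Y₁ ⟶ Spec (.of k)}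

lemma flat_of_field {Z : Scheme.{u}} (z : Z ⟶ Spec (.of k)) : Flat z := by
  have : IsIntegral (Spec (.of k)) := inferInstance
  have : Subsingleton (Spec (.of k)) := inferInstanceAs (Subsingleton (PrimeSpectrum k))
  infer_instance

/-- The truncations of a family over an affine curve with a local parameter are the base changes
of the fibre, if the family receives a suitable morphism from a trivial family. -/
theorem exists_isPullback_truncation (hφ : ρ.comp φ = RingHom.id k)
    (hρ : RingHom.ker ρ = Ideal.span {t}) (ht : t ∈ nonZeroDivisors A) (hm : m ≠ 0)
    (hg : g ≫ pY = pX) (H : IsPullback pr pX x₀ (Spec.map (CommRingCat.ofHom φ)))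
    (hgO : ∀ V, IsIso (g.app V)) (hcl : IsClosedMap g) [QuasiCompact g] [QuasiSeparated g]
    [QuasiSeparated x₀]
    (HY₁ : IsPullback jY₁ y₁ pY (Spec.map (CommRingCat.ofHom ρ)))
    (HY : IsPullback jY pY' pY (Spec.map (CommRingCat.ofHom (Ideal.Quotient.mk (Ideal.span {t ^ m}))))) :
    ∃ θ : Y' ⟶ Y₁, IsPullback θ pY' y₁
      (Spec.map (CommRingCat.ofHom ((Ideal.Quotient.mk (Ideal.span {t ^ m})).comp φ))) := by
  have hρs : Function.Surjective ρ := fun x ↦ ⟨φ x, congr($hφ x)⟩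
  have htρ : ρ t = 0 := by rw [← RingHom.mem_ker, hρ]; exact Ideal.mem_span_singleton_self t
  -- The `k`-point of the truncation; it uses `m ≠ 0`.
  let ρ' : A ⧸ Ideal.span {t ^ m} →+* k := Ideal.Quotient.lift _ ρ fun a ha ↦ by
    obtain ⟨b, rfl⟩ := Ideal.mem_span_singleton.mp ha
    rw [map_mul, map_pow, htρ, zero_pow hm, zero_mul]
  have hρ'mk : ρ'.comp (Ideal.Quotient.mk _) = ρ := by ext; rfl
  have hρ's : Function.Surjective ρ' := fun x ↦ ⟨Ideal.Quotient.mk _ (φ x), congr($hφ x)⟩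
  have hn (b) (hb : ρ' b = 0) : IsNilpotent b := by
    obtain ⟨a, rfl⟩ := Ideal.Quotient.mk_surjective b
    have ha : a ∈ RingHom.ker ρ := hb
    rw [hρ, Ideal.mem_span_singleton] at ha
    refine ⟨m, ?_⟩
    rw [← map_pow, Ideal.Quotient.eq_zero_iff_mem, Ideal.mem_span_singleton]
    exact pow_dvd_pow_of_dvd ha m
  have hs := surjective_specMap_of_isNilpotent ρ' hρ's hn
  have : IsClosedImmersion (Spec.map (CommRingCat.ofHom ρ')) :=
    IsClosedImmersion.spec_of_surjective _ hρ's
  have hc₁ : Spec.map (CommRingCat.ofHom ρ') ≫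
      Spec.map (CommRingCat.ofHom (Ideal.Quotient.mk (Ideal.span {t ^ m}))) =
      Spec.map (CommRingCat.ofHom ρ) := by
    rw [← Spec.map_comp, ← CommRingCat.ofHom_comp, hρ'mk]
  have hc₂ : Spec.map (CommRingCat.ofHom ρ) ≫ Spec.map (CommRingCat.ofHom φ) = 𝟙 _ := by
    rw [← Spec.map_comp, ← CommRingCat.ofHom_comp, hφ]
    exact Spec.map_id _
  have := flat_of_field x₀
  have (Z : Scheme.{u}) (z : Z ⟶ Spec (.of A)) :
    Flat (z ≫ Spec.map (CommRingCat.ofHom φ)) := flat_of_field _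
  have : Surjective (𝟙 (Spec (.of k))) := inferInstance
  -- The same criterion serves twice: with equation `t` for the fibre, and below with `t ^ m` for
  -- the truncation.
  have hg₁ := isIso_app_of_isPullback_specMap (r := 𝟙 _) hg H hgO hcl ht hρs hρ
    (by rw [Category.id_comp, hc₂]) HY₁ (IsPullback.of_hasPullback g jY₁)
  have hr : Spec.map (CommRingCat.ofHom ρ') ≫
      Spec.map (CommRingCat.ofHom (Ideal.Quotient.mk (Ideal.span {t ^ m}))) ≫
      Spec.map (CommRingCat.ofHom φ) = 𝟙 _ := by rw [reassoc_of% hc₁, hc₂]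
  have hg' := isIso_app_of_isPullback_specMap hg H hgO hcl (pow_mem ht m)
    Ideal.Quotient.mk_surjective Ideal.mk_ker hr HY (IsPullback.of_hasPullback g jY)
  rw [CommRingCat.ofHom_comp, Spec.map_comp]
  exact exists_isPullback_of_thickening hg H hr (hc₁ ▸ HY₁) (IsPullback.of_hasPullback g jY₁) hg₁
    HY (IsPullback.of_hasPullback g jY) hg'

end Truncation

/-! ### From the affine neighbourhood to the curve -/

section Globalization

variable {X Y X' Y' : Scheme.{u}} {g : X ⟶ Y} {g' : X' ⟶ Y'} {jX : X' ⟶ X} {jY : Y' ⟶ Y}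

lemma isIso_app_of_isPullback_openImmersion [IsOpenImmersion jY] (HX : IsPullback jX g' g jY)
    (hgO : ∀ V, IsIso (g.app V)) (V : Y'.Opens) : IsIso (g'.app V) := by
  have : IsOpenImmersion jX :=
    MorphismProperty.of_isPullback (P := @IsOpenImmersion) HX.flip inferInstance
  obtain ⟨V', rfl⟩ : ∃ V', jY ⁻¹ᵁ (jY ''ᵁ V') = V := ⟨V, jY.preimage_image_eq V⟩
  have hr : g ⁻¹ᵁ (jY ''ᵁ V') ≤ jX.opensRange := by
    intro x hx
    obtain ⟨y, -, hy⟩ : g x ∈ jY ''ᵁ V' := hx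
    obtain ⟨z, hz, -⟩ := Scheme.Pullback.exists_preimage_pullback x y hy.symm
    refine ⟨HX.isoPullback.inv z, ?_⟩
    rw [← Scheme.Hom.comp_apply, HX.isoPullback_inv_fst, hz]
  have h₁ := jX.isIso_app _ hr
  have h₂ := hgO (jY ''ᵁ V')
  have h₃ : IsIso (jY.app (jY ''ᵁ V')) := inferInstance
  have h₄ : IsIso ((jX ≫ g).app (jY ''ᵁ V')) := by
    rw [Scheme.Hom.comp_app]
    exact @IsIso.comp_isIso _ _ _ _ _ _ _ h₂ h₁
  have h₅ : IsIso ((g' ≫ jY).app (jY ''ᵁ V')) := by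
    rw [Scheme.Hom.congr_app HX.w.symm]
    exact @IsIso.comp_isIso _ _ _ _ _ _ _ h₄ inferInstance
  rw [Scheme.Hom.comp_app] at h₅
  exact @IsIso.of_isIso_comp_left _ _ _ _ _ (jY.app (jY ''ᵁ V')) _ h₃ h₅

variable {k : Type u} [Field k] {C : Scheme.{u}} {c : C ⟶ Spec (.of k)} {W : C.Opens}

lemma fromSpec_comp_eq (hW : IsAffineOpen W) : hW.fromSpec ≫ c = Spec.map (scalars c W) := by
  rw [← IsAffineOpen.SpecMap_appLE_fromSpec c (isAffineOpen_top _) hW le_top,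
    IsAffineOpen.fromSpec_top, scalars, Spec.map_comp]
  congr 1
  exact Scheme.isoSpec_Spec_inv _

/-- `IsTrivialFamily` puts no condition on `X₀`, but `X₀` is the fibre of `X` at the point `κ` and
so inherits one. -/
lemma quasiSeparated_of_isPullback {X₀ K : Scheme.{u}} {pX : X ⟶ C} {pr : X ⟶ X₀} {c : C ⟶ K}
    {x₀ : X₀ ⟶ K} (H : IsPullback pr pX x₀ c) [QuasiSeparated pX] {κ : K ⟶ C}
    (hκ : κ ≫ c = 𝟙 K) : QuasiSeparated x₀ := by
  have h := (IsPullback.of_hasPullback pX κ).paste_horiz H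
  rw [hκ] at h
  have := h.isIso_fst_of_isIso
  have hx : x₀ = inv (pullback.fst pX κ ≫ pr) ≫ pullback.snd pX κ := by
    rw [IsIso.eq_inv_comp, h.w, Category.comp_id]
  rw [hx]
  infer_instance

/-- The infinitesimal neighbourhoods of a fibre are base changes of that fibre. -/
theorem exists_isPullback_of_local_parameter {pX : X ⟶ C} {pY : Y ⟶ C} [IsProper pX] [IsSeparated pY]
    [IsIntegral C] (hg : g ≫ pY = pX) (hgO : ∀ V, IsIso (g.app V)) (htriv : IsTrivialFamily c pX)
    (hW : IsAffineOpen W) {t : Γ(C, W)} (ht : t ≠ 0) {ρ : Γ(C, W) →+* k}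
    (hφ : ρ.comp (scalars c W).hom = RingHom.id k) (hρ : RingHom.ker ρ = Ideal.span {t})
    {Y₁ : Scheme.{u}} {jY₁ : Y₁ ⟶ Y} {y₁ : Y₁ ⟶ Spec (.of k)}
    (HY₁ : IsPullback jY₁ y₁ pY (Spec.map (CommRingCat.ofHom ρ) ≫ hW.fromSpec))
    {R : Type u} [CommRing R] {ψ : Γ(C, W) →+* R} {m : ℕ} (hm : m ≠ 0) (hψ : ψ (t ^ m) = 0)
    {pY' : Y' ⟶ Spec (.of R)} {τ : Spec (.of R) ⟶ C}
    (hτ : τ = Spec.map (CommRingCat.ofHom ψ) ≫ hW.fromSpec) (HY : IsPullback jY pY' pY τ) :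
    ∃ θ : Y' ⟶ Y₁, IsPullback θ pY' y₁ (τ ≫ c) := by
  obtain ⟨X₀, x₀, e, he⟩ := htriv
  have H : IsPullback (e.hom ≫ pullback.fst _ _) pX x₀ c :=
    .of_iso (.of_hasPullback x₀ c) e.symm (.refl _) (.refl _) (.refl _) (by simp) (by simp [← he])
      (by simp) (by simp)
  have hcφ : Spec.map (CommRingCat.ofHom ρ) ≫ hW.fromSpec ≫ c = 𝟙 _ := by
    rw [fromSpec_comp_eq, ← CommRingCat.ofHom_hom (scalars c W), ← Spec.map_comp,
      ← CommRingCat.ofHom_comp, hφ]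
    exact Spec.map_id _
  have hx₀ : QuasiSeparated x₀ := quasiSeparated_of_isPullback H
    (κ := Spec.map (CommRingCat.ofHom ρ) ≫ hW.fromSpec) (by rw [Category.assoc, hcφ])
  have : IsProper g := by
    have : IsProper (g ≫ pY) := hg ▸ inferInstance
    exact .of_comp g pY
  -- the families over the affine open set
  have HYS := IsPullback.of_hasPullback pY hW.fromSpec
  have HXS := IsPullback.of_hasPullback g (pullback.fst pY hW.fromSpec)
  have hgS := isIso_app_of_isPullback_openImmersion HXS hgO
  -- A point of `W` makes `Γ(C, W)` a domain, so that `t ≠ 0` is a nonzerodivisor.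
  have : Nonempty W := ⟨⟨hW.fromSpec (Spec.map (CommRingCat.ofHom ρ) default), by
    rw [← SetLike.mem_coe, ← hW.range_fromSpec]
    exact ⟨_, rfl⟩⟩⟩
  have ht' : t ∈ nonZeroDivisors Γ(C, W) := mem_nonZeroDivisors_of_ne_zero ht
  obtain ⟨a₁, ha₁, ha₁'⟩ : ∃ a : Y₁ ⟶ pullback pY hW.fromSpec, a ≫ pullback.fst _ _ = jY₁ ∧
      a ≫ pullback.snd _ _ = y₁ ≫ Spec.map (CommRingCat.ofHom ρ) :=
    ⟨_, HYS.lift_fst _ _ (by rw [HY₁.w, Category.assoc]), HYS.lift_snd _ _ _⟩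
  have HA₁ : IsPullback a₁ y₁ (pullback.snd pY hW.fromSpec) (Spec.map (CommRingCat.ofHom ρ)) :=
    .of_right (by rwa [ha₁]) ha₁' HYS
  obtain ⟨a, ha, ha'⟩ : ∃ a : Y' ⟶ pullback pY hW.fromSpec, a ≫ pullback.fst _ _ = jY ∧
      a ≫ pullback.snd _ _ = pY' ≫ Spec.map (CommRingCat.ofHom ψ) :=
    ⟨_, HYS.lift_fst _ _ (by rw [HY.w, hτ, Category.assoc]), HYS.lift_snd _ _ _⟩
  have HA : IsPullback a pY' (pullback.snd pY hW.fromSpec) (Spec.map (CommRingCat.ofHom ψ)) :=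
    .of_right (by rwa [ha, ← hτ]) ha' HYS
  -- Through `ψ'`, `Y'` is a base change of the truncation of `Y` modulo `t ^ m`, to which the
  -- affine result applies.
  let ψ' : Γ(C, W) ⧸ Ideal.span {t ^ m} →+* R := Ideal.Quotient.lift _ ψ fun x hx ↦ by
    obtain ⟨b, rfl⟩ := Ideal.mem_span_singleton.mp hx
    rw [map_mul, hψ, zero_mul]
  have hψ' : ψ'.comp (Ideal.Quotient.mk _) = ψ := by ext; rfl
  have hψc : Spec.map (CommRingCat.ofHom ψ') ≫
      Spec.map (CommRingCat.ofHom (Ideal.Quotient.mk (Ideal.span {t ^ m}))) =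
      Spec.map (CommRingCat.ofHom ψ) := by
    rw [← Spec.map_comp, ← CommRingCat.ofHom_comp, hψ']
  have HM := IsPullback.of_hasPullback (pullback.snd pY hW.fromSpec)
    (Spec.map (CommRingCat.ofHom (Ideal.Quotient.mk (Ideal.span {t ^ m}))))
  obtain ⟨b, hb, hb'⟩ : ∃ b : Y' ⟶ pullback (pullback.snd pY hW.fromSpec)
      (Spec.map (CommRingCat.ofHom (Ideal.Quotient.mk (Ideal.span {t ^ m})))),
      b ≫ pullback.fst _ _ = a ∧ b ≫ pullback.snd _ _ = pY' ≫ Spec.map (CommRingCat.ofHom ψ') :=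
    ⟨_, HM.lift_fst _ _ (by rw [HA.w, Category.assoc, hψc]), HM.lift_snd _ _ _⟩
  have HB : IsPullback b pY' (pullback.snd _ _) (Spec.map (CommRingCat.ofHom ψ')) :=
    .of_right (by rwa [hb, hψc]) hb' HM
  have HXS' : IsPullback (pullback.fst g (pullback.fst pY hW.fromSpec))
      (pullback.snd g (pullback.fst pY hW.fromSpec) ≫ pullback.snd pY hW.fromSpec) pX hW.fromSpec :=
    hg ▸ HXS.paste_vert HYS
  have HS := HXS'.paste_horiz H
  rw [fromSpec_comp_eq] at HS
  have hgSp : IsProper (pullback.snd g (pullback.fst pY hW.fromSpec)) := inferInstance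
  obtain ⟨θ, hθ⟩ := exists_isPullback_truncation hφ hρ ht' hm rfl HS hgS
    (pullback.snd g (pullback.fst pY hW.fromSpec)).isClosedMap HA₁ HM
  refine ⟨b ≫ θ, ?_⟩
  have h := HB.paste_horiz hθ
  rw [← Spec.map_comp, ← CommRingCat.ofHom_comp, ← RingHom.comp_assoc, hψ'] at h
  rwa [hτ, Category.assoc, fromSpec_comp_eq, ← CommRingCat.ofHom_hom (scalars c W), ← Spec.map_comp,
    ← CommRingCat.ofHom_comp]

end Globalization

/-! ### The rings `R_n` -/

section TruncationsOfHenselization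

open IsLocalRing

variable {k : Type u} [Field k] {R' : Type u} [CommRing R'] [IsLocalRing R']

/-- The map to the residue field, which is `k`; its kernel is the image of the maximal ideal. -/
lemma exists_residue_truncRing {χ : k →+* R'} (hχ : Function.Surjective ((residue R').comp χ))
    (n : ℕ) : ∃ ρ : TruncRing R' n →+* k,
      ρ.comp ((Ideal.Quotient.mk _).comp χ) = RingHom.id k ∧ ∀ b, ρ b = 0 → b ^ (n + 1) = 0 := by
  let e : k ≃+* ResidueField R' := RingEquiv.ofBijective _ ⟨RingHom.injective _, hχ⟩
  refine ⟨Ideal.Quotient.lift _ (e.symm.toRingHom.comp (residue R')) fun x hx ↦ ?_, ?_, ?_⟩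
  · have hx' : residue R' x = 0 := (residue_eq_zero_iff x).mpr (Ideal.pow_le_self n.succ_ne_zero hx)
    rw [RingHom.comp_apply, hx', map_zero]
  · ext x
    exact e.symm_apply_apply x
  · intro b hb
    obtain ⟨b, rfl⟩ := Ideal.Quotient.mk_surjective b
    have hb' : e.symm (residue R' b) = 0 := hb
    rw [map_eq_zero_iff _ e.symm.injective, residue_eq_zero_iff] at hb'
    rw [← map_pow, Ideal.Quotient.eq_zero_iff_mem]
    exact Ideal.pow_mem_pow hb' _

variable {C Y : Scheme.{u}} (pY : Y ⟶ C) {Q : C} (i : C.presheaf.stalk Q →+* R') (n : ℕ)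

/-- The functions on a neighbourhood of `Q`, as elements of `R_n`. -/
def germTrunc {W : C.Opens} (hQ : Q ∈ W) : Γ(C, W) →+* TruncRing R' n :=
  (Ideal.Quotient.mk _).comp (i.comp (C.presheaf.germ W Q hQ).hom)

lemma truncToCurve_eq {W : C.Opens} (hW : IsAffineOpen W) (hQ : Q ∈ W) :
    truncToCurve Q i n = Spec.map (CommRingCat.ofHom (germTrunc i n hQ)) ≫ hW.fromSpec := by
  rw [truncToCurve, ← hW.fromSpecStalk_eq_fromSpecStalk hQ, IsAffineOpen.fromSpecStalk,
    truncToHensel, henselToLocal, germTrunc, CommRingCat.ofHom_comp, CommRingCat.ofHom_comp,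
    Spec.map_comp, Spec.map_comp, Category.assoc, Category.assoc, CommRingCat.ofHom_hom]
  rfl

lemma germTrunc_pow_eq_zero [IsLocalHom i] {W : C.Opens} (hQ : Q ∈ W) {t : Γ(C, W)}
    (ht : Q ∉ C.basicOpen t) : germTrunc i n hQ (t ^ (n + 1)) = 0 := by
  rw [map_pow, germTrunc, RingHom.comp_apply, ← map_pow, Ideal.Quotient.eq_zero_iff_mem]
  refine Ideal.pow_mem_pow ?_ _
  rw [RingHom.comp_apply, mem_maximalIdeal, mem_nonunits_iff, isUnit_map_iff]
  exact fun h ↦ ht ((C.mem_basicOpen t Q hQ).mpr h)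

lemma exists_isPullback_truncFamily :
    ∃ j : truncFamily pY Q i n ⟶ Y,
      IsPullback j (truncFamilyHom pY Q i n) pY (truncToCurve Q i n) :=
  ⟨_, ((IsPullback.of_hasPullback (henselFamilyHom pY Q i) (truncToHensel R' n)).paste_horiz
    (IsPullback.of_hasPullback (localFamilyHom pY Q) (henselToLocal Q i))).paste_horiz
      (IsPullback.of_hasPullback pY (C.fromSpecStalk Q)) |> fun h ↦ by
        rw [Category.assoc] at h
        exact h⟩

variable {c : C ⟶ Spec (.of k)}

/-- A function on `W` is a constant modulo `t`, and `t` vanishes at `Q`; so fractions of functions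
have residues in `k`. -/
lemma surjective_residue_germ_scalars {W : C.Opens} (hW : IsAffineOpen W) (hQ : Q ∈ W)
    {t : Γ(C, W)} (ht : Q ∉ C.basicOpen t) {ρ : Γ(C, W) →+* k}
    (hφ : ρ.comp (scalars c W).hom = RingHom.id k) (hρ : RingHom.ker ρ = Ideal.span {t}) :
    Function.Surjective ((residue (C.presheaf.stalk Q)).comp
      ((C.presheaf.germ W Q hQ).hom.comp (scalars c W).hom)) := by
  have ht' : residue (C.presheaf.stalk Q) (C.presheaf.germ W Q hQ t) = 0 := by
    rw [residue_eq_zero_iff, mem_maximalIdeal, mem_nonunits_iff]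
    exact fun h ↦ ht ((C.mem_basicOpen t Q hQ).mpr h)
  have key (a : Γ(C, W)) : residue (C.presheaf.stalk Q) (C.presheaf.germ W Q hQ a) =
      ((residue (C.presheaf.stalk Q)).comp
      ((C.presheaf.germ W Q hQ).hom.comp (scalars c W).hom)) (ρ a) := by
    have h : a - (scalars c W).hom (ρ a) ∈ RingHom.ker ρ := by
      rw [RingHom.mem_ker, map_sub, sub_eq_zero]
      exact congr($hφ (ρ a)).symm
    rw [hρ, Ideal.mem_span_singleton] at h
    obtain ⟨b, hb⟩ := h
    rw [← sub_eq_zero]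
    change residue (C.presheaf.stalk Q) (C.presheaf.germ W Q hQ a) -
      residue (C.presheaf.stalk Q) (C.presheaf.germ W Q hQ ((scalars c W).hom (ρ a))) = 0
    rw [← map_sub, ← map_sub, hb, map_mul, map_mul, ht', zero_mul]
  intro x
  obtain ⟨s, rfl⟩ := residue_surjective x
  let _ : Algebra Γ(C, W) (C.presheaf.stalk Q) := (C.presheaf.germ W Q hQ).hom.toAlgebra
  have hloc := hW.isLocalization_stalk ⟨Q, hQ⟩
  obtain ⟨a, b, h⟩ := IsLocalization.exists_mk'_eq (hW.primeIdealOf ⟨Q, hQ⟩).asIdeal.primeCompl s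
  have h1 := IsLocalization.mk'_spec (C.presheaf.stalk Q) a b
  rw [h] at h1
  have hu : IsUnit (C.presheaf.germ W Q hQ b.1) :=
    IsLocalization.map_units (C.presheaf.stalk Q) b
  have h1' : s * C.presheaf.germ W Q hQ b.1 = C.presheaf.germ W Q hQ a := h1
  have h2 := congr(residue (C.presheaf.stalk Q) $h1')
  rw [map_mul] at h2
  have hb0 : residue (C.presheaf.stalk Q) (C.presheaf.germ W Q hQ b.1) ≠ 0 :=
    (hu.map (residue (C.presheaf.stalk Q))).ne_zero
  refine ⟨ρ a / ρ b.1, ?_⟩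
  rw [map_div₀, ← key, ← key, ← h2, mul_div_cancel_right₀ _ hb0]

end TruncationsOfHenselization

end KSFamily

end

theorem proposition2p4
    (k : Type u) [Field k] [CharZero k] [IsAlgClosed k]
    -- `C` is a smooth projective curve over `k`
    (C : Scheme.{u}) (c : C ⟶ Spec (.of k)) [IsIntegral C] [SmoothOfRelativeDimension 1 c]
    (hC : KSFamily.IsProjectiveMorphism c)
    -- `X` and `Y` are projective over `C`, `Y` is reduced, and `X` is a trivial family
    (X Y : Scheme.{u}) (pX : X ⟶ C) (pY : Y ⟶ C)
    (hX : KSFamily.IsProjectiveMorphism pX) (hY : KSFamily.IsProjectiveMorphism pY)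
    [IsReduced Y] (hX_triv : KSFamily.IsTrivialFamily c pX)
    -- `g : X ⟶ Y` is a `C`-morphism with `𝒪_Y ≅ g_* 𝒪_X`
    (g : X ⟶ Y) (hg : g ≫ pY = pX) (hgO : ∀ V : Y.Opens, IsIso (g.app V))
    -- `Y` is flat over the open set `U`, and `Q` is a closed point in `U`
    (U : C.Opens) [Flat (pY ∣_ U)] (Q : C) (hQU : Q ∈ U) (hQ : IsClosed ({Q} : Set C))
    -- `R'` is the henselization of `R = 𝒪_{C,Q}`
    (R' : Type u) [CommRing R'] [IsLocalRing R'] (i : C.presheaf.stalk Q →+* R')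
    (hi : KSFamily.IsHenselization i) (n : ℕ) :
    -- the sequence of differentials of `Y_n ⟶ Spec R_n` is split exact
    Nonempty (KSFamily.differentialSequence (KSFamily.truncFamilyHom pY Q i n)
      (KSFamily.truncToCurve Q i n ≫ c)).Splitting ∧
    -- it is short exact, with vanishing (Kodaira–Spencer) extension class
    (∃ hs : (KSFamily.differentialSequence (KSFamily.truncFamilyHom pY Q i n)
        (KSFamily.truncToCurve Q i n ≫ c)).ShortExact,
      KSFamily.kodairaSpencerExtClass _ _ hs = 0) ∧
    -- `Y_n ⟶ Spec R_n` is trivial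
    KSFamily.IsTrivialFamily (KSFamily.truncToCurve Q i n ≫ c)
      (KSFamily.truncFamilyHom pY Q i n) ∧
    -- more precisely `Y_n ≅ Y_0 ×_k Spec R_n` over `R_n`
    ∃ e : KSFamily.truncFamily pY Q i n ≅
        pullback (KSFamily.truncFamilyHom pY Q i 0 ≫ KSFamily.truncToCurve Q i 0 ≫ c)
          (KSFamily.truncToCurve Q i n ≫ c),
      e.hom ≫ pullback.snd _ _ = KSFamily.truncFamilyHom pY Q i n := by
  have := hX.isProper
  have := hY.isProper
  have := hi.isLocalHom
  obtain ⟨W, hW, hQW, t, ht, htQ, hbij⟩ := KSFamily.exists_affine_local_parameter c hQ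
  obtain ⟨ρ, hφ, hρ⟩ : ∃ ρ : Γ(C, W) →+* k, ρ.comp (KSFamily.scalars c W).hom = RingHom.id k ∧
      RingHom.ker ρ = Ideal.span {t} := by
    let e := RingEquiv.ofBijective _ hbij
    refine ⟨e.symm.toRingHom.comp (Ideal.Quotient.mk _), ?_, ?_⟩
    · ext x
      exact e.symm_apply_apply x
    · ext x
      rw [RingHom.mem_ker, ← Ideal.Quotient.eq_zero_iff_mem]
      exact map_eq_zero_iff e.symm e.symm.injective
  have hχ := hi.surjective_residue _
    (KSFamily.surjective_residue_germ_scalars hW hQW htQ hφ hρ)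
  have hτ (m : ℕ) : KSFamily.truncToCurve Q i m ≫ c = Spec.map (CommRingCat.ofHom
      ((KSFamily.germTrunc i m hQW).comp (KSFamily.scalars c W).hom)) := by
    rw [KSFamily.truncToCurve_eq i m hW hQW, Category.assoc, KSFamily.fromSpec_comp_eq,
      CommRingCat.ofHom_comp, Spec.map_comp, CommRingCat.ofHom_hom]
  have hpull (m : ℕ) : ∃ θ, IsPullback θ (KSFamily.truncFamilyHom pY Q i m)
      (pullback.snd pY (Spec.map (CommRingCat.ofHom ρ) ≫ hW.fromSpec))
      (KSFamily.truncToCurve Q i m ≫ c) := by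
    obtain ⟨j, hj⟩ := KSFamily.exists_isPullback_truncFamily pY i m
    exact KSFamily.exists_isPullback_of_local_parameter hg hgO hX_triv hW ht hφ hρ
      (.of_hasPullback _ _) m.succ_ne_zero (KSFamily.germTrunc_pow_eq_zero i m hQW htQ)
      (KSFamily.truncToCurve_eq i m hW hQW) hj
  obtain ⟨θ, hθ⟩ := hpull n
  obtain ⟨θ₀, hθ₀⟩ := hpull 0
  obtain ⟨s⟩ : Nonempty (KSFamily.differentialSequence (KSFamily.truncFamilyHom pY Q i n)
      (KSFamily.truncToCurve Q i n ≫ c)).Splitting := by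
    -- Because the kernel of `r` is nilpotent, `Spec R_n` is one point and the fibre maps onto
    -- `Y_n`, as the splitting criterion requires.
    obtain ⟨r, hr, hn⟩ := KSFamily.exists_residue_truncRing hχ n
    have hs := KSFamily.surjective_specMap_of_isNilpotent r (fun x ↦ ⟨_, congr($hr x)⟩)
      fun b hb ↦ ⟨_, hn b hb⟩
    have hrs : Spec.map (CommRingCat.ofHom r) ≫ KSFamily.truncToCurve Q i n ≫ c = 𝟙 _ := by
      rw [hτ, ← Spec.map_comp, ← CommRingCat.ofHom_comp]
      exact congr(Spec.map (CommRingCat.ofHom $hr)).trans (Spec.map_id _)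
    have : Subsingleton (Spec (.of k)) := inferInstanceAs (Subsingleton (PrimeSpectrum k))
    have : Subsingleton (Spec (.of (KSFamily.TruncRing R' n))) := hs.surj.subsingleton
    obtain ⟨σ, hσ, -, Hσ⟩ := KSFamily.exists_section_of_isPullback hθ hrs
    have : Surjective σ := MorphismProperty.of_isPullback (P := @Surjective) Hσ.flip inferInstance
    exact KSFamily.nonempty_splitting_of_isPullback hθ
      (KSFamily.exists_preimage_eq_of_section hσ σ.surjective) (KSFamily.surjective_of_section hσ)
  refine ⟨⟨s⟩, ⟨s.shortExact, ?_⟩, ⟨_, _, hθ.isoPullback, hθ.isoPullback_hom_snd⟩, ?_⟩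
  · let _ := HasExt.standard (KSFamily.truncFamily pY Q i n).Modules
    exact KSFamily.extClass_eq_zero_of_splitting s.shortExact s
  -- `R_0 = k`, so `θ₀` identifies `Y_0` with the fibre over the point `ρ`.
  · have : IsIso (KSFamily.truncToCurve Q i 0 ≫ c) := by
      obtain ⟨r, hr, hn⟩ := KSFamily.exists_residue_truncRing hχ 0
      rw [hτ]
      have : IsIso (CommRingCat.ofHom
          ((KSFamily.germTrunc i 0 hQW).comp (KSFamily.scalars c W).hom)) := by
        refine (ConcreteCategory.isIso_iff_bijective _).mpr
          ⟨Function.LeftInverse.injective (g := r) fun x ↦ congr($hr x), fun b ↦ ⟨r b, ?_⟩⟩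
        -- For `n = 0` the nilpotency exponent is `0 + 1`, so the kernel of `r` is zero.
        rw [← sub_eq_zero, ← pow_one (_ - b)]
        refine hn _ ?_
        rw [map_sub, sub_eq_zero]
        exact congr($hr (r b))
      infer_instance
    have := hθ₀.isIso_fst_of_isIso
    have H : IsPullback (θ ≫ inv θ₀) (KSFamily.truncFamilyHom pY Q i n)
        (KSFamily.truncFamilyHom pY Q i 0 ≫ KSFamily.truncToCurve Q i 0 ≫ c)
        (KSFamily.truncToCurve Q i n ≫ c) :=
      .of_iso hθ (.refl _) (asIso θ₀).symm (.refl _) (.refl _) (by simp) (by simp)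
        (by simp [hθ₀.w]) (by simp)
    exact ⟨H.isoPullback, H.isoPullback_hom_snd⟩
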